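/- \textbf{Conventions.} For $\sigma=+1$ let $\mathbb V_\sigma=\mathbb R^{1,3}$ with $\eta_\sigma=\mathrm{diag}(-1,1,1,1)$, $\mathcal O_\sigma=\mathrm O(1,3)$; for $\sigma=-1$ let $\mathbb V_\sigma=\mathbb R^{2,2}$ with $\eta_\sigma=\mathrm{diag}(-1,-1,1,1)$, $\mathcal O_\sigma=\mathrm O(2,2)$. Put $\langle X,Y\rangle=X^\top\eta_\sigma Y$ and $\mathcal M_\sigma=\{X:\langle X,X\rangle=\sigma\}$, so $\mathcal M_{+1}=\mathrm{dS}^3$, $\mathcal M_{-1}=\mathrm{AdS}^3$, and $T_p\mathcal M_\sigma=p^\perp$. On $\mathbb R^{1,2}$ let $\langle u,w\rangle_T=u^\top\eta_T w$ with $\eta_T=\mathrm{diag}(-1,1,1)$, $(u\times w)^\mu=\eta_T^{\mu\lambda}\varepsilon_{\lambda\nu\rho}u^\nu w^\rho$ with $\varepsilon_{012}=1$, and $J(u)w=u\times w$. A \emph{strictly convex generalized tetrahedron} in $\mathcal M_\sigma$ consists of linearly independent outward normals $N_1,\dots,N_4\in\mathbb V_\sigma$ (defined up to positive scale) and vertices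 $V_1,\dots,V_4\in\mathcal M_\sigma$ with $\langle V_i,N_j\rangle=0$ for $i\ne j$, such that the region $T=\{X\in\mathcal M_\sigma:\langle X,N_i\rangle\le 0\ \forall i\}$ is the section of $\mathcal M_\sigma$ by the closed cone generated by $V_1,\dots,V_4$, each $V_i$ is interior in $\mathcal M_\sigma$ to the $i$-th half-space $\langle X,N_i\rangle\le0$, and $T\cap N_i^\perp$ is the section of $\mathcal M_\sigma$ by the closed cone generated by the three vertices other than $V_i$. (The region and its faces may pass through infinity.) Let $o_{ab}:T_{V_b}\mathcal M_\sigma\to T_{V_a}\mathcal M_\sigma$ be transport along the edge from $V_b$ to $V_a$. If $\sigma\langle V_a,V_b\rangle>-1$, the segment $[V_b,V_a]$ projects radially to a geodesic arc in $\mathcal M_\sigma$, and $o_{ab}$ is Levi-Civita parallel transport along it. If $c:=\sigma\langle V_a,V_b\rangle<-1$, the edge passes through infinity, and $o_{ab}$ is the linear map which fixes the vectors orthogonal to $V_a$ and $V_b$ and carries the initial velocity $V_a-cV_b$ of the edge to its final velocity $cV_a-V_b$. If $c=-1$ there is no edge transport, and based holonomies are defined only when all $o_{ab}$ are. With base vertex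 $V_4$ and special edge $V_2V_4$, the \emph{based Levi-Civita face holonomies} are $$\widehat O_1=o_{43}o_{32}o_{24},\quad \widehat O_2=o_{41}o_{13}o_{34},\quad \widehat O_3=o_{42}o_{21}o_{14},\quad \widehat O_4=o_{42}o_{23}o_{31}o_{12}o_{24},$$ expressed as matrices in an oriented, time-oriented pseudo-orthonormal frame of $T_{V_4}\mathcal M_\sigma$ (for fixed orientations of $\mathcal M_\sigma$), and the \emph{transported normals} are $N_1,N_2,N_3\in T_{V_4}\mathcal M_\sigma$ and $o_{42}N_4\in T_{V_4}\mathcal M_\sigma$, in the same frame. \textbf{Theorem (Holonomy Minkowski theorem for tetrahedra in $\mathrm{dS}^3$ and $\mathrm{AdS}^3$).} \label{theorem:unified_minkowski} Let $O_1,\dots,O_4\in\mathrm{SO}^+(1,2)$, $O_i\neq\mathrm{id}$, with $O_4O_3O_2O_1=\mathrm{id}$. For each $i$ let $n_i$ be a representative of the line $\ker(O_i-\mathrm{id})$: a vector with $\langle n_i,n_i\rangle_T=\pm1$ if this line is non-null, and the null vector with $O_i=\exp J(n_i)$ if it is null ($O_i$ parabolic). Let $G=G(n)$ be the symmetric $4\times4$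 matrix with $G_{ij}=\langle n_i,n_j\rangle_T$ except $G_{24}=G_{42}=\langle n_2,O_1n_4\rangle_T$, and put $$\chi_1=\langle n_3\times n_2,O_3^{-1}n_4\rangle_T,\quad \chi_2=\langle n_1\times n_3,n_4\rangle_T,\quad \chi_3=\langle n_2\times n_1,O_1n_4\rangle_T,\quad \chi_4=\langle n_1\times n_2,n_3\rangle_T .$$ Assume that $G$ and its four principal $3\times3$ submatrices are nondegenerate and, if some $O_i$ is parabolic, that the data are admissible: the signs of the non-null $n_i$ can be changed, keeping the null ones, so that $\chi_1,\dots,\chi_4$ have one common nonzero sign. Let $\sigma_G=-\operatorname{sgn}\det G$. Then: 1. There is exactly one family $m=(m_1,\dots,m_4)$ with $m_i\in\{n_i,-n_i\}$ all of whose triple products $\chi_i$ are positive (the outward branch); there is one sign $s=\pm1$ with $m_i=s\,n_i$ for all null $n_i$. 2. There is a strictly convex generalized tetrahedron $T_G$ in $\mathcal M_{\sigma_G}$ (that is, in $\mathrm{dS}^3$ if $\det G<0$ and in $\mathrm{AdS}^3$ if $\det G>0$), with suitably scaled outward normals $N_i$, such that $\langle N_i,N_j\rangle=G(m)_{ij}$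 for all $i,j$, where $G(m)$ is the matrix above formed with $m$ (so $G(m)=G$ up to simultaneous sign changes of rows and columns), and such that, in one oriented and time-oriented pseudo-orthonormal frame at $V_4$, its transported normals are $m_1,\dots,m_4$ and its based Levi-Civita face holonomies are exactly $\widehat O_i(T_G)=O_i$, $i=1,\dots,4$. 3. $T_G$ is unique: every strictly convex generalized tetrahedron in $\mathcal M_{\sigma'}$, $\sigma'=\pm1$, that has outward normals with Gram matrix $G(m)$, or whose based Levi-Civita face holonomies in some oriented and time-oriented pseudo-orthonormal frame are $O_1,\dots,O_4$, lies in $\mathcal M_{\sigma_G}$ and is the image of $T_G$ (with its labelled vertices and faces) under an element of $\mathcal O_{\sigma_G}$. -/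

import Mathlib

open Matrix Set Topology

noncomputable section

namespace HolMink

/-! ### The two ambient models -/

/-- The two model geometries: de Sitter space and anti-de Sitter space, of dimension three. -/
inductive Model
  | dS
  | AdS

/-- The sign `σ`: `+1` for de Sitter space, `-1` for anti-de Sitter space. -/
def Model.sgn : Model → ℝ
  | .dS => 1
  | .AdS => -1

/-- The ambient metric: `diag(-1,1,1,1)` for de Sitter, `diag(-1,-1,1,1)` for anti-de Sitter. -/
def Model.eta : Model → Matrix (Fin 4) (Fin 4) ℝ
  | .dS => Matrix.diagonal ![-1, 1, 1, 1]
  | .AdS => Matrix.diagonal ![-1, -1, 1, 1]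

/-- The ambient inner product `Xᵀ η_σ Y`. -/
def ambip (σ : Model) (X Y : Fin 4 → ℝ) : ℝ := X ⬝ᵥ (σ.eta *ᵥ Y)

/-- The space `M_σ = {X | ⟨X, X⟩ = σ}`. -/
def space (σ : Model) : Set (Fin 4 → ℝ) := {X | ambip σ X X = σ.sgn}

/-- The full ambient isometry group, `O(1,3)` or `O(2,2)`. -/
def IsAmbientIsometry (σ : Model) (L : Matrix (Fin 4) (Fin 4) ℝ) : Prop :=
  Lᵀ * σ.eta * L = σ.eta

/-- The tangent space `T_p M_σ = p^⊥`. -/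
def tangent (σ : Model) (p : Fin 4 → ℝ) : Submodule ℝ (Fin 4 → ℝ) where
  carrier := {Y | ambip σ Y p = 0}
  add_mem' := by
    intro a b ha hb
    simp only [Set.mem_ofPred_eq, ambip, add_dotProduct] at *
    rw [ha, hb, add_zero]
  zero_mem' := by simp [ambip]
  smul_mem' := by
    intro c a ha
    simp only [Set.mem_ofPred_eq, ambip, smul_dotProduct] at *
    rw [ha, smul_zero]

/-! ### Levi-Civita transport -/

/-- The orthogonal projection of an ambient vector `Y` onto `T_p M_σ`, for `p ∈ M_σ`. -/
def tangentProj (σ : Model) (p Y : Fin 4 → ℝ) : Fin 4 → ℝ :=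
  Y - (σ.sgn * ambip σ Y p) • p

/-- `X` is a Levi-Civita parallel vector field along the curve `γ : [0,1] → M_σ`: it is tangent to
`M_σ`, and its covariant derivative (the tangential part of its ambient derivative) vanishes. -/
def IsParallelAlong (σ : Model) (γ X : ℝ → Fin 4 → ℝ) : Prop :=
  ∀ t ∈ Icc (0 : ℝ) 1, ambip σ (X t) (γ t) = 0 ∧
    ∃ X' : Fin 4 → ℝ, HasDerivWithinAt X X' (Icc 0 1) t ∧ tangentProj σ (γ t) X' = 0

/-- The straight ambient segment from `p` to `q`. -/
def chord (p q : Fin 4 → ℝ) (t : ℝ) : Fin 4 → ℝ := (1 - t) • p + t • q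

/-- The radial projection of the segment to `M_σ`: the geodesic arc from `p` to `q`, as long as
`σ ⟨Y, Y⟩ > 0` along the segment. -/
def edgeArc (σ : Model) (p q : Fin 4 → ℝ) (t : ℝ) : Fin 4 → ℝ :=
  (Real.sqrt (σ.sgn * ambip σ (chord p q t) (chord p q t)))⁻¹ • chord p q t

/-- `L : T_p M_σ → T_q M_σ` is the transport along the edge from `p` to `q`.

* Ordinary edge: the segment from `p` to `q` projects radially to a geodesic arc of `M_σ`, and `L` is
  Levi-Civita parallel transport along that arc.
* Edge through infinity (`σ ⟨p,q⟩ < -1`): the section of `M_σ` by the cone over `p` and `q` consists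
  of two geodesic rays; the edge leaves `p` along the first ray, with velocity the tangential part
  `q - σ⟨p,q⟩ p` of `q - p`, and comes in from infinity to `q` along the second one, with velocity
  `σ⟨p,q⟩ q - p`. The transport carries the velocity to the velocity and fixes the constant vectors
  normal to the plane of the geodesic. (On ordinary non-null edges the same description holds.) -/
def IsEdgeTransport (σ : Model) (p q : Fin 4 → ℝ)
    (L : tangent σ p →ₗ[ℝ] tangent σ q) : Prop :=
  ((∀ t ∈ Icc (0 : ℝ) 1, 0 < σ.sgn * ambip σ (chord p q t) (chord p q t)) ∧
    ∀ v : tangent σ p, ∃ X : ℝ → Fin 4 → ℝ,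
      IsParallelAlong σ (edgeArc σ p q) X ∧ X 0 = v ∧ X 1 = L v) ∨
  (σ.sgn * ambip σ p q < -1 ∧
    (∀ v : tangent σ p, ambip σ v q = 0 → (L v : Fin 4 → ℝ) = v) ∧
    (∀ v : tangent σ p, (v : Fin 4 → ℝ) = q - (σ.sgn * ambip σ p q) • p →
      (L v : Fin 4 → ℝ) = (σ.sgn * ambip σ p q) • q - p))

/-! ### Generalized tetrahedra

The faces and vertices `1, 2, 3, 4` carry the indices `0, 1, 2, 3`. -/

/-- The closed half-space of `M_σ` on the non-positive side of `N`. -/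
def halfSpace (σ : Model) (N : Fin 4 → ℝ) : Set (Fin 4 → ℝ) := {X ∈ space σ | ambip σ X N ≤ 0}

/-- The totally geodesic surface `N^⊥ ∩ M_σ`. -/
def face (σ : Model) (N : Fin 4 → ℝ) : Set (Fin 4 → ℝ) := {X ∈ space σ | ambip σ X N = 0}

/-- The intersection of the four half-spaces. -/
def region (σ : Model) (N : Fin 4 → Fin 4 → ℝ) : Set (Fin 4 → ℝ) := ⋂ i, halfSpace σ (N i)

/-- The (projective) simplex of `M_σ` with the vertices `V i`, `i ∈ S`: the section of `M_σ` by the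
closed cone over these vertices. -/
def simplex (σ : Model) (V : Fin 4 → Fin 4 → ℝ) (S : Set (Fin 4)) : Set (Fin 4 → ℝ) :=
  {X ∈ space σ | ∃ c : Fin 4 → ℝ, (∀ i, 0 ≤ c i) ∧ (∀ i, i ∉ S → c i = 0) ∧ X = ∑ i, c i • V i}

/-- A generalized tetrahedron in `M_σ`, with its half-spaces `⟨X, N i⟩ ≤ 0` and labelled
vertices; `V i` is opposite to the `i`-th face. -/
structure IsGeneralizedTetrahedron (σ : Model) (N V : Fin 4 → Fin 4 → ℝ) : Prop where
  linearIndependent : LinearIndependent ℝ N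
  vertex_mem : ∀ i j, j ≠ i → V i ∈ face σ (N j)
  region_eq : region σ N = simplex σ V Set.univ

/-- Strict convexity: each vertex is interior (in `M_σ`) to the half-space of the opposite face, and
each face of the region is the triangle with the remaining three vertices. -/
structure IsStrictlyConvexTetrahedron (σ : Model) (N V : Fin 4 → Fin 4 → ℝ) : Prop
    extends IsGeneralizedTetrahedron σ N V where
  vertex_interior : ∀ i, halfSpace σ (N i) ∈ 𝓝[space σ] (V i)
  face_eq : ∀ i, region σ N ∩ face σ (N i) = simplex σ V {i}ᶜ

/-- Two labelled tetrahedra in `M_σ` differ by an ambient isometry (outward normals are compared up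
to positive scale). -/
def CongruentTetrahedra (σ : Model) (N V N' V' : Fin 4 → Fin 4 → ℝ) : Prop :=
  ∃ L : Matrix (Fin 4) (Fin 4) ℝ, IsAmbientIsometry σ L ∧
    (∀ i, V' i = L *ᵥ V i) ∧ (∀ i, ∃ c : ℝ, 0 < c ∧ N' i = c • (L *ᵥ N i)) ∧
    region σ N' = (fun X => L *ᵥ X) '' region σ N

/-! ### Based face holonomies -/

/-- A timelike tangent vector `e` at `p ∈ M_σ` is future directed, for the time orientation given by
`∂₀` on de Sitter space and by the rotation field `(-p₁, p₀, 0, 0)` on anti-de Sitter space. -/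
def IsFuture : Model → (Fin 4 → ℝ) → (Fin 4 → ℝ) → Prop
  | .dS, _, e => 0 < e 0
  | .AdS, p, e => 0 < p 0 * e 1 - p 1 * e 0

/-- The tangent metric `diag(-1,1,1)`. -/
def etaT : Matrix (Fin 3) (Fin 3) ℝ := Matrix.diagonal ![-1, 1, 1]

/-- An oriented and time-oriented pseudo-orthonormal frame of `T_p M_σ`. -/
structure IsFrame (σ : Model) (p : Fin 4 → ℝ) (E : Fin 3 → tangent σ p) : Prop where
  orthonormal : ∀ a b, ambip σ (E a) (E b) = etaT a b
  oriented : 0 < (Matrix.of ![p, (E 0 : Fin 4 → ℝ), (E 1 : Fin 4 → ℝ), (E 2 : Fin 4 → ℝ)]).det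
  future : IsFuture σ p (E 0)

/-- `o a b` is the transport from `V b` to `V a` along the edge joining them. -/
def IsTransportSystem (σ : Model) (V : Fin 4 → Fin 4 → ℝ)
    (o : ∀ a b : Fin 4, tangent σ (V b) →ₗ[ℝ] tangent σ (V a)) : Prop :=
  ∀ a b, a ≠ b → IsEdgeTransport σ (V b) (V a) (o a b)

/-- The holonomies of the four simple face loops based at the fourth vertex; the special edge
joins the second and the fourth vertex. -/
def faceHolonomy {σ : Model} {V : Fin 4 → Fin 4 → ℝ}
    (o : ∀ a b : Fin 4, tangent σ (V b) →ₗ[ℝ] tangent σ (V a)) :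
    Fin 4 → (tangent σ (V 3) →ₗ[ℝ] tangent σ (V 3)) :=
  ![o 3 2 ∘ₗ o 2 1 ∘ₗ o 1 3,
    o 3 0 ∘ₗ o 0 2 ∘ₗ o 2 3,
    o 3 1 ∘ₗ o 1 0 ∘ₗ o 0 3,
    o 3 1 ∘ₗ o 1 2 ∘ₗ o 2 0 ∘ₗ o 0 1 ∘ₗ o 1 3]

/-- In the frame `E` at the base vertex, the based face holonomies have the matrices `O i`. -/
def HolonomiesAre {σ : Model} {V : Fin 4 → Fin 4 → ℝ}
    (o : ∀ a b : Fin 4, tangent σ (V b) →ₗ[ℝ] tangent σ (V a)) (E : Fin 3 → tangent σ (V 3))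
    (O : Fin 4 → Matrix (Fin 3) (Fin 3) ℝ) : Prop :=
  ∀ i b, faceHolonomy o i (E b) = ∑ a, O i a b • E a

/-- The matrices `O i` are the based Levi-Civita face holonomies of the tetrahedron with vertices
`V i`, in some oriented and time-oriented pseudo-orthonormal frame at the base vertex. -/
def HasBasedHolonomies (σ : Model) (V : Fin 4 → Fin 4 → ℝ)
    (O : Fin 4 → Matrix (Fin 3) (Fin 3) ℝ) : Prop :=
  ∃ (E : Fin 3 → tangent σ (V 3)) (o : ∀ a b : Fin 4, tangent σ (V b) →ₗ[ℝ] tangent σ (V a)),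
    IsFrame σ (V 3) E ∧ IsTransportSystem σ V o ∧ HolonomiesAre o E O

/-- In the frame `E`, the transported intrinsic normals have the coordinates `m i`: the first three
normals are tangent at the base vertex, the fourth one is tangent at the second vertex and is
brought to the base vertex along the special edge. -/
def TransportedNormalsAre {σ : Model} {V : Fin 4 → Fin 4 → ℝ} (N : Fin 4 → Fin 4 → ℝ)
    (o : ∀ a b : Fin 4, tangent σ (V b) →ₗ[ℝ] tangent σ (V a)) (E : Fin 3 → tangent σ (V 3))
    (m : Fin 4 → Fin 3 → ℝ) : Prop :=
  (∀ i, i ≠ 3 → N i = ∑ a, m i a • (E a : Fin 4 → ℝ)) ∧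
  ∃ w : tangent σ (V 1), (w : Fin 4 → ℝ) = N 3 ∧ o 3 1 w = ∑ a, m 3 a • E a

/-! ### Holonomy data in `SO⁺(1,2)` -/

/-- The tangent inner product on `ℝ^{1,2}`. -/
def tanip (u w : Fin 3 → ℝ) : ℝ := u ⬝ᵥ (etaT *ᵥ w)

/-- The Lorentzian cross product `(u × w)^μ = η^{μλ} ε_{λνρ} u^ν w^ρ`. -/
def lcross (u w : Fin 3 → ℝ) : Fin 3 → ℝ := etaT *ᵥ (crossProduct u w)

/-- The matrix of `w ↦ u × w`. -/
def crossMatrix (u : Fin 3 → ℝ) : Matrix (Fin 3) (Fin 3) ℝ :=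
  Matrix.of fun μ ν => lcross u (Pi.single ν 1) μ

/-- Membership in `SO⁺(1,2)`. -/
def IsSOPlus (O : Matrix (Fin 3) (Fin 3) ℝ) : Prop :=
  Oᵀ * etaT * O = etaT ∧ O.det = 1 ∧ 0 < O 0 0

/-- A parabolic element of `SO⁺(1,2)`. -/
def IsParabolicHolonomy (O : Matrix (Fin 3) (Fin 3) ℝ) : Prop := O ≠ 1 ∧ O.trace = 3

/-- `n` is a representative of the invariant normal line of the nontrivial holonomy `O`: a unit
vector (of either causal sign) fixed by `O`, or the null generator of the nilpotent logarithm
of `O`. -/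
def IsNormalRepresentative (O : Matrix (Fin 3) (Fin 3) ℝ) (n : Fin 3 → ℝ) : Prop :=
  ((tanip n n = -1 ∨ tanip n n = 1) ∧ O *ᵥ n = n) ∨
  (tanip n n = 0 ∧ O = NormedSpace.exp (crossMatrix n))

/-- The reconstructed Gram matrix, with its exceptional entry `⟨n₂, O₁ n₄⟩`. -/
def faceGram (O : Fin 4 → Matrix (Fin 3) (Fin 3) ℝ) (n : Fin 4 → Fin 3 → ℝ) :
    Matrix (Fin 4) (Fin 4) ℝ :=
  Matrix.of fun i j =>
    if (i = 1 ∧ j = 3) ∨ (i = 3 ∧ j = 1) then tanip (n 1) (O 0 *ᵥ n 3) else tanip (n i) (n j)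

/-- The four transported triple products. -/
def chi (O : Fin 4 → Matrix (Fin 3) (Fin 3) ℝ) (n : Fin 4 → Fin 3 → ℝ) : Fin 4 → ℝ :=
  ![tanip (lcross (n 2) (n 1)) ((O 2)⁻¹ *ᵥ n 3),
    tanip (lcross (n 0) (n 2)) (n 3),
    tanip (lcross (n 1) (n 0)) (O 0 *ᵥ n 3),
    tanip (lcross (n 0) (n 1)) (n 2)]

/-- The model with sign `-sgn (det G)`, for nondegenerate `G`. -/
def selectedModel (G : Matrix (Fin 4) (Fin 4) ℝ) : Model := if G.det < 0 then .dS else .AdS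

/-- `m` arises from `n` by changing the signs of some of the four vectors. -/
def SignChange (n m : Fin 4 → Fin 3 → ℝ) : Prop := ∀ i, m i = n i ∨ m i = -n i

/-- Admissibility: with the null representatives kept as they are, the signs of the non-null ones
can be chosen so that the four triple products have one common nonzero sign. -/
def Admissible (O : Fin 4 → Matrix (Fin 3) (Fin 3) ℝ) (n : Fin 4 → Fin 3 → ℝ) : Prop :=
  ∃ m, SignChange n m ∧ (∀ i, tanip (n i) (n i) = 0 → m i = n i) ∧
    ((∀ i, 0 < chi O m i) ∨ (∀ i, chi O m i < 0))

/-- The outward branch: the sign change of `n` for which all four triple products are positive. -/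
def IsOutwardBranch (O : Fin 4 → Matrix (Fin 3) (Fin 3) ℝ) (n m : Fin 4 → Fin 3 → ℝ) : Prop :=
  SignChange n m ∧ ∀ i, 0 < chi O m i

end HolMink

end

open HolMink

noncomputable section

namespace HolMink

/-! ### The ambient bilinear form -/

/-! Transport along every edge, ordinary or through infinity, is the restriction of one ambient map,
the reflection `edgeMap` in the sum of the end points. It is available exactly when that sum is
non-null, and it fixes every normal orthogonal to both end points. This replaces the differential
geometry by linear algebra (`IsEdgeTransport.eq_edgeMap`).

For a tetrahedron, each face loop is a product of reflections fixing the transported face normal,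
and the four loops cancel edge by edge; so its holonomies and transported normals form
`IsHolonomyData`. Carrying the fourth normal to the base along different edges gives `m 3`, `O 0 *ᵥ
m 3` and `(O 2)⁻¹ *ᵥ m 3`. With the right copy, `faceGram` is the true Gram matrix of the normals
(`faceGram_eq_ambip`) and the four triple products acquire a common sign (`exists_chi_pos`).

Conversely, the principal minors of the Gram matrix are `-χ_i²` (`det_submatrix`), so the diagonal
of its inverse has the sign of `-det G`, that is, of `σ`. Hence the matrix is realised by normals in
the selected model, and the dual vectors can be normalised to vertices in `M_σ`. Opposite sides of a
plane rule out null sums of vertices (`edge_ne`), so all transports exist. The holonomies of this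
tetrahedron are the given ones, because positive triple products, the Gram matrix and three of the
normals determine everything else (`eq_of_faceGram_eq`).

A change of signs multiplies `χ_i` by the product of the other three signs, a bijection of the
sixteen sign patterns; this gives exactly one outward branch. For uniqueness, the fixed lines of the
holonomies give the normals up to scale, and the common sign of the triple products leaves only a
global sign, which the Gram matrix does not see (`exists_scale_gram_eq`). The Gram matrix in turn
determines the model and the tetrahedron up to isometry (`eq_model_and_congruent`). -/

theorem Model.sgn_mul_self (σ : Model) : σ.sgn * σ.sgn = 1 := by cases σ <;> simp [Model.sgn]

theorem Model.sgn_ne_zero (σ : Model) : σ.sgn ≠ 0 := by cases σ <;> simp [Model.sgn]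

theorem ambip_eq (σ : Model) (X Y : Fin 4 → ℝ) :
    ambip σ X Y = -(X 0 * Y 0) + σ.sgn * (X 1 * Y 1) + X 2 * Y 2 + X 3 * Y 3 := by
  cases σ <;> simp [ambip, Model.eta, Model.sgn, dotProduct, mulVec_diagonal, Fin.sum_univ_four]

theorem ambip_comm (σ : Model) (X Y : Fin 4 → ℝ) : ambip σ X Y = ambip σ Y X := by
  simp only [ambip_eq]; ring

theorem ambip_add_left (σ : Model) (X Y Z : Fin 4 → ℝ) :
    ambip σ (X + Y) Z = ambip σ X Z + ambip σ Y Z := by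
  simp only [ambip_eq, Pi.add_apply]; ring

theorem ambip_sub_left (σ : Model) (X Y Z : Fin 4 → ℝ) :
    ambip σ (X - Y) Z = ambip σ X Z - ambip σ Y Z := by
  simp only [ambip_eq, Pi.sub_apply]; ring

theorem ambip_smul_left (σ : Model) (c : ℝ) (X Z : Fin 4 → ℝ) :
    ambip σ (c • X) Z = c * ambip σ X Z := by
  simp only [ambip_eq, Pi.smul_apply, smul_eq_mul]; ring

theorem ambip_neg_left (σ : Model) (X Z : Fin 4 → ℝ) : ambip σ (-X) Z = -ambip σ X Z := by
  simp only [ambip_eq, Pi.neg_apply]; ring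

theorem ambip_zero_left (σ : Model) (Z : Fin 4 → ℝ) : ambip σ 0 Z = 0 := by
  simp [ambip_eq]

theorem ambip_add_right (σ : Model) (X Y Z : Fin 4 → ℝ) :
    ambip σ X (Y + Z) = ambip σ X Y + ambip σ X Z := by
  simp only [ambip_eq, Pi.add_apply]; ring

theorem ambip_sub_right (σ : Model) (X Y Z : Fin 4 → ℝ) :
    ambip σ X (Y - Z) = ambip σ X Y - ambip σ X Z := by
  simp only [ambip_eq, Pi.sub_apply]; ring

theorem ambip_smul_right (σ : Model) (c : ℝ) (X Z : Fin 4 → ℝ) :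
    ambip σ X (c • Z) = c * ambip σ X Z := by
  simp only [ambip_eq, Pi.smul_apply, smul_eq_mul]; ring

theorem ambip_neg_right (σ : Model) (X Z : Fin 4 → ℝ) : ambip σ X (-Z) = -ambip σ X Z := by
  simp only [ambip_eq, Pi.neg_apply]; ring

theorem ambip_zero_right (σ : Model) (Z : Fin 4 → ℝ) : ambip σ Z 0 = 0 := by
  simp [ambip_eq]

theorem eq_zero_of_ambip_eq_zero {σ : Model} {X : Fin 4 → ℝ} (h : ∀ Y, ambip σ X Y = 0) :
    X = 0 := by
  have h0 := h (Pi.single 0 1)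
  have h1 := h (Pi.single 1 1)
  have h2 := h (Pi.single 2 1)
  have h3 := h (Pi.single 3 1)
  simp [ambip_eq, Model.sgn_ne_zero] at h0 h1 h2 h3
  ext i; fin_cases i <;> simpa

/-- A vector orthogonal to four linearly independent vectors vanishes. -/
theorem eq_zero_of_orthogonal {σ : Model} {N : Fin 4 → Fin 4 → ℝ} (hN : LinearIndependent ℝ N)
    {X : Fin 4 → ℝ} (h : ∀ i, ambip σ X (N i) = 0) : X = 0 := by
  have hspan : Submodule.span ℝ (Set.range N) = ⊤ :=
    hN.span_eq_top_of_card_eq_finrank' (by simp)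
  apply eq_zero_of_ambip_eq_zero (σ := σ)
  intro Y
  have hY : Y ∈ Submodule.span ℝ (Set.range N) := by rw [hspan]; trivial
  induction hY using Submodule.span_induction with
  | mem x hx => obtain ⟨i, rfl⟩ := hx; exact h i
  | zero => exact ambip_zero_right _ _
  | add x y _ _ hx hy => rw [ambip_add_right, hx, hy, add_zero]
  | smul a x _ hx => rw [ambip_smul_right, hx, mul_zero]

theorem linearIndependent_of_det_ne_zero {M : Matrix (Fin 4) (Fin 4) ℝ} (h : M.det ≠ 0) :
    LinearIndependent ℝ (fun i => M i) :=
  Matrix.linearIndependent_rows_iff_isUnit.2 ((Matrix.isUnit_iff_isUnit_det _).2 h.isUnit)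

theorem mem_tangent {σ : Model} {p v : Fin 4 → ℝ} : v ∈ tangent σ p ↔ ambip σ v p = 0 := Iff.rfl

theorem mem_space {σ : Model} {p : Fin 4 → ℝ} : p ∈ space σ ↔ ambip σ p p = σ.sgn := Iff.rfl

/-! ### The reflection along an edge -/

/-- The reflection in `p + q`; on the tangent space at `p` it is the transport to `q`. -/
def edgeMap (σ : Model) (p q : Fin 4 → ℝ) : (Fin 4 → ℝ) →ₗ[ℝ] (Fin 4 → ℝ) where
  toFun v := v - (σ.sgn / (1 + σ.sgn * ambip σ p q) * ambip σ v (p + q)) • (p + q)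
  map_add' v w := by simp only [ambip_add_left, mul_add, add_smul]; abel
  map_smul' a v := by
    simp only [ambip_smul_left, RingHom.id_apply, smul_sub, smul_smul]
    congr 2; ring

theorem edgeMap_apply (σ : Model) (p q v : Fin 4 → ℝ) :
    edgeMap σ p q v =
      v - (σ.sgn / (1 + σ.sgn * ambip σ p q) * ambip σ v (p + q)) • (p + q) := rfl

theorem edgeMap_comm (σ : Model) (p q : Fin 4 → ℝ) : edgeMap σ p q = edgeMap σ q p := by
  refine LinearMap.ext fun v => ?_
  simp only [edgeMap_apply, ambip_comm σ p q, add_comm p q]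

/-- Applied to a face normal and an edge of that face, this is why face holonomies fix normals. -/
theorem edgeMap_fix {σ : Model} {p q v : Fin 4 → ℝ} (hp : ambip σ v p = 0) (hq : ambip σ v q = 0) :
    edgeMap σ p q v = v := by
  simp [edgeMap_apply, ambip_add_right, hp, hq]

section
variable {σ : Model} {p q : Fin 4 → ℝ} (hp : p ∈ space σ) (hq : q ∈ space σ)
  (hc : 1 + σ.sgn * ambip σ p q ≠ 0)
include hp hc

/-- The vectors `p` and `-q` have the same norm and differ by `p + q`, so the reflection exchanges
them; hence it maps `p^⊥` to `q^⊥`. -/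
theorem edgeMap_left : edgeMap σ p q p = -q := by
  have h : σ.sgn / (1 + σ.sgn * ambip σ p q) * ambip σ p (p + q) = 1 := by
    rw [ambip_add_right, mem_space.1 hp]
    have := σ.sgn_mul_self
    field_simp; linear_combination this
  rw [edgeMap_apply, h]; simp

include hq

theorem ambip_edgeMap (v w : Fin 4 → ℝ) :
    ambip σ (edgeMap σ p q v) (edgeMap σ p q w) = ambip σ v w := by
  simp only [edgeMap_apply, ambip_sub_left, ambip_sub_right, ambip_smul_left, ambip_smul_right,
    ambip_add_left, ambip_add_right, ambip_comm σ p w, ambip_comm σ q w, mem_space.1 hp,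
    mem_space.1 hq, ambip_comm σ q p]
  have := σ.sgn_mul_self
  field_simp
  linear_combination (2 * (ambip σ v p + ambip σ v q) * (ambip σ w p + ambip σ w q) * σ.sgn) * this

theorem edgeMap_edgeMap (v : Fin 4 → ℝ) : edgeMap σ p q (edgeMap σ p q v) = v := by
  have h := σ.sgn_mul_self
  have key : σ.sgn / (1 + σ.sgn * ambip σ p q) * ambip σ (p + q) (p + q) = 2 := by
    simp only [ambip_add_left, ambip_add_right, mem_space.1 hp, mem_space.1 hq, ambip_comm σ q p]
    field_simp; linear_combination 2 * h
  simp only [edgeMap_apply, ambip_sub_left, ambip_smul_left]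
  rw [mul_sub, sub_smul]
  have : σ.sgn / (1 + σ.sgn * ambip σ p q) * (σ.sgn / (1 + σ.sgn * ambip σ p q) * ambip σ v (p + q)
     * ambip σ (p + q) (p + q)) = 2 * (σ.sgn / (1 + σ.sgn * ambip σ p q) * ambip σ v (p + q)) := by
    rw [← key]; ring
  rw [this, mul_smul 2, two_smul]; abel

theorem edgeMap_mem_tangent {v : Fin 4 → ℝ} (hv : ambip σ v p = 0) :
    ambip σ (edgeMap σ p q v) q = 0 := by
  have h := ambip_edgeMap hp hq hc v p
  rw [edgeMap_left hp hc, hv, ambip_neg_right, neg_eq_zero] at h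
  exact h

/-- The edge transport preserves the orientations of the tangent spaces. -/
theorem det_edgeMap (x y z : Fin 4 → ℝ) :
    (Matrix.of ![q, edgeMap σ p q x, edgeMap σ p q y, edgeMap σ p q z]).det =
      (Matrix.of ![p, x, y, z]).det := by
  set k := σ.sgn / (1 + σ.sgn * ambip σ p q) with hk
  have hs := σ.sgn_mul_self
  have key : k * ambip σ (p + q) (p + q) = 2 := by
    rw [hk]
    simp only [ambip_add_left, ambip_add_right, mem_space.1 hp, mem_space.1 hq, ambip_comm σ q p]
    field_simp; linear_combination 2 * hs
  -- A reflection is a rank-one perturbation of the identity, of determinant `1 - 2 = -1`; this sign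
  -- is compensated by `p ↦ -q`.
  have hM : Matrix.of ![edgeMap σ p q p, edgeMap σ p q x, edgeMap σ p q y, edgeMap σ p q z] =
      Matrix.of ![p, x, y, z] *
        (1 + replicateCol Unit (-(k • (σ.eta *ᵥ (p + q)))) * replicateRow Unit (p + q)) := by
    rw [mul_add, mul_one, ← Matrix.mul_assoc]
    have : ∀ v : Fin 4 → ℝ, ∀ j, edgeMap σ p q v j =
        v j + v ⬝ᵥ (-(k • (σ.eta *ᵥ (p + q)))) * (p + q) j := by
      intro v j
      simp only [edgeMap_apply, Pi.sub_apply, Pi.smul_apply, smul_eq_mul, dotProduct_neg,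
        dotProduct_smul, ambip, hk]
      ring
    have hmul : ∀ (A : Matrix (Fin 4) (Fin 4) ℝ) (u w : Fin 4 → ℝ) (i j : Fin 4),
        (A + A * replicateCol Unit u * replicateRow Unit w) i j = A i j + A i ⬝ᵥ u * w j := by
      intro A u w i j
      simp [Matrix.add_apply, Matrix.mul_apply, dotProduct]
    ext i j
    rw [hmul]
    fin_cases i <;> exact this _ j
  have hdet := congrArg Matrix.det hM
  rw [det_mul, det_one_add_replicateCol_mul_replicateRow, dotProduct_neg, dotProduct_smul,
    show (p + q) ⬝ᵥ (σ.eta *ᵥ (p + q)) = ambip σ (p + q) (p + q) from rfl, smul_eq_mul, key,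
    edgeMap_left hp hc] at hdet
  have hneg : (Matrix.of ![-q, edgeMap σ p q x, edgeMap σ p q y, edgeMap σ p q z]).det =
      -(Matrix.of ![q, edgeMap σ p q x, edgeMap σ p q y, edgeMap σ p q z]).det := by
    simp [Matrix.det_succ_row_zero, Fin.sum_univ_succ]
  rw [hneg] at hdet
  linarith

end

/-! ### Levi-Civita transport along an edge -/

theorem sgn_mul_ambip_chord {σ : Model} {p q : Fin 4 → ℝ} (hp : p ∈ space σ) (hq : q ∈ space σ)
    (t : ℝ) : σ.sgn * ambip σ (chord p q t) (chord p q t) =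
      (1 - t) ^ 2 + t ^ 2 + 2 * t * (1 - t) * (σ.sgn * ambip σ p q) := by
  simp only [chord, ambip_add_left, ambip_add_right, ambip_smul_left, ambip_smul_right,
    mem_space.1 hp, mem_space.1 hq, ambip_comm σ q p]
  linear_combination ((1 - t) ^ 2 + t ^ 2) * σ.sgn_mul_self

theorem chord_pos {c t : ℝ} (hc : -1 < c) (ht : t ∈ Icc (0 : ℝ) 1) :
    0 < (1 - t) ^ 2 + t ^ 2 + 2 * t * (1 - t) * c := by
  have h : 0 ≤ t * (1 - t) := mul_nonneg ht.1 (by linarith [ht.2])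
  nlinarith [mul_nonneg h (by linarith : (0:ℝ) ≤ 1 + c), sq_nonneg (1 - 2 * t), ht.1, ht.2]

/-- The reflections of `v` in the vectors `p + τ q`. -/
def reflectedField (σ : Model) (p q v : Fin 4 → ℝ) (τ : ℝ) : Fin 4 → ℝ :=
  v - (2 * σ.sgn * ambip σ v q) •
    ((τ / (1 + τ ^ 2 + 2 * τ * (σ.sgn * ambip σ p q))) • p +
      (τ ^ 2 / (1 + τ ^ 2 + 2 * τ * (σ.sgn * ambip σ p q))) • q)

/-- The rational parametrization of the geodesic from `p` to `q`. -/
def rationalArc (σ : Model) (p q : Fin 4 → ℝ) (τ : ℝ) : Fin 4 → ℝ :=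
  ((1 - τ ^ 2) / (1 + τ ^ 2 + 2 * τ * (σ.sgn * ambip σ p q))) • p +
    ((2 * τ + 2 * (σ.sgn * ambip σ p q) * τ ^ 2) /
      (1 + τ ^ 2 + 2 * τ * (σ.sgn * ambip σ p q))) • q

/-- The rational arc is minus the reflection of `p` in `p + τ q`. The derivative of the reflected
field is a multiple of the position on this arc, hence normal to `M_σ`: the field is parallel. -/
theorem hasDerivAt_reflectedField (σ : Model) (p q v : Fin 4 → ℝ) {τ : ℝ}
    (hQ : 1 + τ ^ 2 + 2 * τ * (σ.sgn * ambip σ p q) ≠ 0) :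
    HasDerivAt (reflectedField σ p q v)
      ((-(2 * σ.sgn * ambip σ v q) / (1 + τ ^ 2 + 2 * τ * (σ.sgn * ambip σ p q))) •
        rationalArc σ p q τ) τ := by
  have hQ' : HasDerivAt (fun τ : ℝ => 1 + τ ^ 2 + 2 * τ * (σ.sgn * ambip σ p q))
      (2 * τ + 2 * (σ.sgn * ambip σ p q)) τ := by
    have h1 := ((hasDerivAt_id' τ).fun_pow 2).const_add 1
    have h2 := ((hasDerivAt_id' τ).const_mul 2).mul_const (σ.sgn * ambip σ p q)
    exact (h1.fun_add h2).congr_deriv (by simp)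
  have h1 := ((hasDerivAt_id' τ).fun_div hQ' hQ).smul_const p
  have h2 := (((hasDerivAt_id' τ).fun_pow 2).fun_div hQ' hQ).smul_const q
  refine (((h1.fun_add h2).fun_const_smul (2 * σ.sgn * ambip σ v q)).const_sub v).congr_deriv ?_
  ext i
  simp only [rationalArc, Pi.smul_apply, Pi.add_apply, Pi.neg_apply, smul_eq_mul, Nat.cast_ofNat]
  obtain ⟨Q, hQe⟩ : ∃ Q, Q = 1 + τ ^ 2 + 2 * τ * (σ.sgn * ambip σ p q) := ⟨_, rfl⟩
  rw [← hQe] at hQ ⊢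
  field_simp
  rw [hQe]
  ring

section
variable {σ : Model} {p q : Fin 4 → ℝ} (hp : p ∈ space σ) (hq : q ∈ space σ)
include hp hq

theorem ambip_rationalArc_self {τ : ℝ}
    (hQ : 1 + τ ^ 2 + 2 * τ * (σ.sgn * ambip σ p q) ≠ 0) :
    ambip σ (rationalArc σ p q τ) (rationalArc σ p q τ) = σ.sgn := by
  have hs := σ.sgn_mul_self
  obtain ⟨c, hc⟩ : ∃ c, c = σ.sgn * ambip σ p q := ⟨_, rfl⟩
  have hpq : ambip σ p q = σ.sgn * c := by rw [hc]; linear_combination (-ambip σ p q) * hs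
  rw [← hc] at hQ
  simp only [rationalArc, ambip_add_left, ambip_add_right, ambip_smul_left, ambip_smul_right,
    mem_space.1 hp, mem_space.1 hq, ambip_comm σ q p, ← hc]
  rw [hpq]
  obtain ⟨Q, hQe⟩ : ∃ Q, Q = 1 + τ ^ 2 + 2 * τ * c := ⟨_, rfl⟩
  rw [← hQe] at hQ ⊢
  field_simp
  rw [hQe]
  ring

/-- The same reflection carries `v` to the field and `-p` to the point of the arc, so orthogonality
is inherited. -/
theorem ambip_reflectedField_rationalArc {v : Fin 4 → ℝ} (hv : ambip σ v p = 0) {τ : ℝ}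
    (hQ : 1 + τ ^ 2 + 2 * τ * (σ.sgn * ambip σ p q) ≠ 0) :
    ambip σ (reflectedField σ p q v τ) (rationalArc σ p q τ) = 0 := by
  have hs := σ.sgn_mul_self
  obtain ⟨c, hc⟩ : ∃ c, c = σ.sgn * ambip σ p q := ⟨_, rfl⟩
  have hpq : ambip σ p q = σ.sgn * c := by rw [hc]; linear_combination (-ambip σ p q) * hs
  rw [← hc] at hQ
  simp only [reflectedField, rationalArc, ambip_add_left, ambip_add_right, ambip_smul_left,
    ambip_smul_right, ambip_sub_left, mem_space.1 hp, mem_space.1 hq, ambip_comm σ q p, hv, ← hc]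
  rw [hpq]
  obtain ⟨Q, hQe⟩ : ∃ Q, Q = 1 + τ ^ 2 + 2 * τ * c := ⟨_, rfl⟩
  rw [← hQe] at hQ ⊢
  field_simp
  rw [hQe]
  linear_combination (-(2 * ambip σ v q * τ * (1 + τ * c) * (1 + τ ^ 2 + 2 * τ * c))) * hs

theorem edgeArc_eq_rationalArc (hc : -1 < σ.sgn * ambip σ p q) :
    ∃ τ : ℝ → ℝ, τ 0 = 0 ∧ τ 1 = 1 ∧ ∀ t ∈ Icc (0 : ℝ) 1, DifferentiableAt ℝ τ t ∧
      1 + τ t ^ 2 + 2 * τ t * (σ.sgn * ambip σ p q) ≠ 0 ∧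
      edgeArc σ p q t = rationalArc σ p q (τ t) := by
  obtain ⟨c, hce⟩ : ∃ c, c = σ.sgn * ambip σ p q := ⟨_, rfl⟩
  have hf := sgn_mul_ambip_chord hp hq
  simp only [← hce] at hc hf ⊢
  -- With `r` the length of the chord vector, the reflection taking `-p` to the arc point `chord /
  -- r` is the one in `p + chord / r`, proportional to `(r + 1 - t) p + t q`. The ratio of these
  -- coefficients is `τ`.
  refine ⟨fun t => t / (√((1 - t) ^ 2 + t ^ 2 + 2 * t * (1 - t) * c) + (1 - t)), by simp, by simp,
    fun t ht => ?_⟩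
  have hpos := chord_pos hc ht
  obtain ⟨r, hr⟩ : ∃ r, r = √((1 - t) ^ 2 + t ^ 2 + 2 * t * (1 - t) * c) := ⟨_, rfl⟩
  have hr0 : 0 < r := hr ▸ Real.sqrt_pos.2 hpos
  have hr2 : r ^ 2 = (1 - t) ^ 2 + t ^ 2 + 2 * t * (1 - t) * c := hr ▸ Real.sq_sqrt hpos.le
  obtain ⟨d, hd⟩ : ∃ d, d = r + (1 - t) := ⟨_, rfl⟩
  have hd0 : 0 < d := by linarith [ht.2]
  have hτ : 0 ≤ t / d := div_nonneg ht.1 hd0.le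
  have hQ0 : 0 < 1 + (t / d) ^ 2 + 2 * (t / d) * c := by
    rcases hτ.eq_or_lt with h | h
    · rw [← h]; norm_num
    · nlinarith [sq_nonneg (1 - t / d), mul_pos h (by linarith : 0 < 1 + c)]
  have hQ : 1 + (t / d) ^ 2 + 2 * (t / d) * c = 2 * r * (d + t * c) / d ^ 2 := by
    field_simp
    rw [hd]
    linear_combination (-1) * hr2
  simp only [← hr, ← hd]
  refine ⟨?_, hQ0.ne', ?_⟩
  · refine DifferentiableAt.fun_div differentiableAt_id (DifferentiableAt.fun_add
      (DifferentiableAt.sqrt (by fun_prop) hpos.ne') (by fun_prop)) ?_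
    rw [← hr, ← hd]; exact hd0.ne'
  · have hdt : d + t * c ≠ 0 := by
      intro h; rw [hQ, h] at hQ0; simp at hQ0
    rw [edgeArc, hf, ← hr, rationalArc, ← hce, hQ, chord, smul_add, smul_smul, smul_smul]
    congr 2
    · field_simp
      rw [hd]
      linear_combination (-1) * hr2
    · field_simp

/-- The edge map is the Levi-Civita transport along an ordinary edge. -/
theorem exists_isParallelAlong (hc : -1 < σ.sgn * ambip σ p q) {v : Fin 4 → ℝ}
    (hv : ambip σ v p = 0) :
    ∃ X, IsParallelAlong σ (edgeArc σ p q) X ∧ X 0 = v ∧ X 1 = edgeMap σ p q v := by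
  obtain ⟨τ, h0, h1, h⟩ := edgeArc_eq_rationalArc hp hq hc
  refine ⟨fun t => reflectedField σ p q v (τ t), fun t ht => ?_, ?_, ?_⟩
  · obtain ⟨hτ, hQ, hγ⟩ := h t ht
    rw [hγ]
    refine ⟨ambip_reflectedField_rationalArc hp hq hv hQ, _,
      ((hasDerivAt_reflectedField σ p q v hQ).scomp t hτ.hasDerivAt).hasDerivWithinAt, ?_⟩
    rw [smul_smul, tangentProj, ambip_smul_left, ambip_rationalArc_self hp hq hQ]
    rw [← sub_smul]
    convert zero_smul ℝ _ using 2
    linear_combination (-(deriv τ t * (-(2 * σ.sgn * ambip σ v q) /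
      (1 + τ t ^ 2 + 2 * τ t * (σ.sgn * ambip σ p q))))) * σ.sgn_mul_self
  · simp [h0, reflectedField]
  · have : 1 + σ.sgn * ambip σ p q ≠ 0 := by linarith
    simp only [h1, reflectedField, edgeMap_apply, ambip_add_right, hv, ← smul_add, smul_smul,
      one_pow]
    congr 2
    have h2 : (1 : ℝ) + 1 + 2 * 1 * (σ.sgn * ambip σ p q) = 2 * (1 + σ.sgn * ambip σ p q) := by ring
    rw [h2]
    field_simp
    ring

-- Metric compatibility. Tested against known parallel fields, it yields uniqueness of parallel
-- transport without a uniqueness theorem for differential equations.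
omit hp hq in
theorem ambip_eq_of_isParallelAlong {γ X Y : ℝ → Fin 4 → ℝ} (hX : IsParallelAlong σ γ X)
    (hY : IsParallelAlong σ γ Y) : ambip σ (X 1) (Y 1) = ambip σ (X 0) (Y 0) := by
  have key : ∀ t ∈ Icc (0 : ℝ) 1,
      HasDerivWithinAt (fun t => ambip σ (X t) (Y t)) 0 (Icc 0 1) t := by
    intro t ht
    obtain ⟨hX0, X', hX', hXp⟩ := hX t ht
    obtain ⟨hY0, Y', hY', hYp⟩ := hY t ht
    rw [hasDerivWithinAt_pi] at hX' hY'
    have e1 : ambip σ X' (Y t) = 0 := by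
      rw [tangentProj, sub_eq_zero] at hXp
      rw [hXp, ambip_smul_left, ambip_comm σ (γ t), hY0, mul_zero]
    have e2 : ambip σ (X t) Y' = 0 := by
      rw [tangentProj, sub_eq_zero] at hYp
      rw [hYp, ambip_smul_right, hX0, mul_zero]
    simp only [ambip_eq] at e1 e2 ⊢
    refine (((((hX' 0).fun_mul (hY' 0)).fun_neg).fun_add (((hX' 1).fun_mul (hY' 1)).const_mul
      σ.sgn)).fun_add ((hX' 2).fun_mul (hY' 2))).fun_add ((hX' 3).fun_mul (hY' 3))
      |>.congr_deriv ?_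
    linear_combination e1 + e2
  exact constant_of_derivWithin_zero (fun t ht => (key t ht).differentiableWithinAt)
    (fun t ht => (key t ⟨ht.1, ht.2.le⟩).derivWithin
      (uniqueDiffOn_Icc zero_lt_one t ⟨ht.1, ht.2.le⟩)) 1 ⟨zero_le_one, le_rfl⟩

omit hp in
/-- A tangent vector orthogonal to the tangent space vanishes. -/
theorem eq_zero_of_orthogonal_tangent {x : Fin 4 → ℝ} (hx : ambip σ x q = 0)
    (h : ∀ u, ambip σ u q = 0 → ambip σ x u = 0) : x = 0 := by
  apply eq_zero_of_ambip_eq_zero (σ := σ)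
  intro Y
  have h1 := h (Y - (σ.sgn * ambip σ Y q) • q) (by
    rw [ambip_sub_left, ambip_smul_left, mem_space.1 hq]
    linear_combination (-ambip σ Y q) * σ.sgn_mul_self)
  rwa [ambip_sub_right, ambip_smul_right, hx, mul_zero, sub_zero] at h1

/-- The transport along an edge exists only if `σ⟨p,q⟩ ≠ -1`, and it is the edge map. -/
theorem IsEdgeTransport.eq_edgeMap {L : tangent σ p →ₗ[ℝ] tangent σ q}
    (hL : IsEdgeTransport σ p q L) :
    1 + σ.sgn * ambip σ p q ≠ 0 ∧ ∀ v, (L v : Fin 4 → ℝ) = edgeMap σ p q v := by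
  rcases hL with ⟨hpos, hL⟩ | ⟨hlt, hfix, hvel⟩
  -- At the midpoint of the chord the positive quantity is `(1 + c) / 2`.
  · have hc : -1 < σ.sgn * ambip σ p q := by
      have := hpos (1 / 2) ⟨by norm_num, by norm_num⟩
      rw [sgn_mul_ambip_chord hp hq] at this
      linarith
    have hc' : 1 + σ.sgn * ambip σ p q ≠ 0 := by linarith
    refine ⟨hc', fun v => ?_⟩
    have hv : ambip σ v p = 0 := v.2
    obtain ⟨X, hX, hX0, hX1⟩ := hL v
    rw [← sub_eq_zero]
    refine eq_zero_of_orthogonal_tangent (σ := σ) hq (q := q) ?_ fun u hu => ?_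
    · rw [ambip_sub_left, edgeMap_mem_tangent hp hq hc' hv, sub_zero]
      exact (L v).2
    -- The test vector `u` at `q` is reflected back to `p`; the explicit parallel field starting
    -- there ends at `u`, so the product of `L v` with `u` is known.
    · have hcu : 1 + σ.sgn * ambip σ q p ≠ 0 := by rwa [ambip_comm]
      have hw := edgeMap_mem_tangent hq hp hcu hu
      obtain ⟨Y, hY, hY0, hY1⟩ := exists_isParallelAlong hp hq hc hw
      have h := ambip_eq_of_isParallelAlong hX hY
      have hinv : edgeMap σ p q (edgeMap σ q p u) = u := by
        rw [edgeMap_comm σ q p, edgeMap_edgeMap hp hq hc']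
      rw [hX0, hX1, hY0, hY1, ← ambip_edgeMap hp hq hc' v, hinv] at h
      rw [ambip_sub_left, h, sub_self]
  · have hc' : 1 + σ.sgn * ambip σ p q ≠ 0 := by linarith
    refine ⟨hc', fun v => ?_⟩
    have hs := σ.sgn_mul_self
    have hv : ambip σ v p = 0 := v.2
    obtain ⟨c, hce⟩ : ∃ c, c = σ.sgn * ambip σ p q := ⟨_, rfl⟩
    have hpq : ambip σ p q = σ.sgn * c := by rw [hce]; linear_combination (-ambip σ p q) * hs
    rw [← hce] at hlt hvel hc'
    have hw : ambip σ (q - c • p) p = 0 := by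
      rw [ambip_sub_left, ambip_smul_left, mem_space.1 hp, ambip_comm, hpq]; ring
    have hd : 1 - c ^ 2 ≠ 0 := by nlinarith
    set w : tangent σ p := ⟨q - c • p, hw⟩ with hwd
    -- The quotient `⟨v,q⟩ / ⟨w,q⟩`: it makes `v - k w` orthogonal to `q`, splitting `v` into a
    -- velocity part and a part fixed by the transport.
    set k := σ.sgn * ambip σ v q / (1 - c ^ 2) with hk
    have hLw : (L w : Fin 4 → ℝ) = c • q - p := hvel w rfl
    have hu : ambip σ ((v - k • w : tangent σ p) : Fin 4 → ℝ) q = 0 := by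
      simp only [Submodule.coe_sub, Submodule.coe_smul, hwd, ambip_sub_left, ambip_smul_left,
        mem_space.1 hq, hpq, hk]
      field_simp
      linear_combination (-ambip σ v q) * hs
    have hLu := hfix _ hu
    rw [map_sub, map_smul] at hLu
    simp only [Submodule.coe_sub, Submodule.coe_smul, hLw] at hLu
    rw [sub_eq_iff_eq_add] at hLu
    rw [hLu, edgeMap_apply, ambip_add_right, hv, zero_add, ← hce]
    simp only [hwd]
    have hk2 : σ.sgn / (1 + c) * ambip σ v q = k * (1 - c) := by
      rw [hk]; field_simp; ring
    rw [hk2]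
    module

/-- Away from `σ⟨p,q⟩ = -1` the transport exists. -/
theorem exists_isEdgeTransport (hc : 1 + σ.sgn * ambip σ p q ≠ 0) :
    ∃ L : tangent σ p →ₗ[ℝ] tangent σ q, IsEdgeTransport σ p q L := by
  refine ⟨(edgeMap σ p q).restrict fun v hv =>
    mem_tangent.2 (edgeMap_mem_tangent hp hq hc (mem_tangent.1 hv)), ?_⟩
  rcases lt_or_gt_of_ne hc with h | h
  · right
    refine ⟨by linarith, fun v hv => edgeMap_fix v.2 hv, fun v hv => ?_⟩
    have hs := σ.sgn_mul_self
    change edgeMap σ p q (v : Fin 4 → ℝ) = _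
    rw [hv, map_sub, map_smul, edgeMap_left hp hc, edgeMap_comm,
      edgeMap_left hq (by rwa [ambip_comm])]
    module
  · left
    refine ⟨fun t ht => ?_, fun v => exists_isParallelAlong hp hq (by linarith) v.2⟩
    rw [sgn_mul_ambip_chord hp hq]
    exact chord_pos (by linarith) ht

end

/-! ### Lorentzian vector algebra -/

theorem tanip_eq (u w : Fin 3 → ℝ) : tanip u w = -(u 0 * w 0) + u 1 * w 1 + u 2 * w 2 := by
  simp [tanip, etaT, dotProduct, mulVec_diagonal, Fin.sum_univ_three]

theorem lcross_apply_zero (u w : Fin 3 → ℝ) : lcross u w 0 = -(u 1 * w 2 - u 2 * w 1) := by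
  simp [lcross, etaT, mulVec_diagonal, crossProduct]

theorem lcross_apply_one (u w : Fin 3 → ℝ) : lcross u w 1 = u 2 * w 0 - u 0 * w 2 := by
  simp [lcross, etaT, mulVec_diagonal, crossProduct]

theorem lcross_apply_two (u w : Fin 3 → ℝ) : lcross u w 2 = u 0 * w 1 - u 1 * w 0 := by
  simp [lcross, etaT, mulVec_diagonal, crossProduct]

theorem tanip_lcross (u v w : Fin 3 → ℝ) : tanip (lcross u v) w = (Matrix.of ![u, v, w]).det := by
  rw [tanip_eq, lcross_apply_zero, lcross_apply_one, lcross_apply_two, det_fin_three]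
  simp
  ring

theorem tanip_comm (u w : Fin 3 → ℝ) : tanip u w = tanip w u := by
  simp only [tanip_eq]; ring

theorem tanip_add_right (u v w : Fin 3 → ℝ) : tanip u (v + w) = tanip u v + tanip u w := by
  simp only [tanip_eq, Pi.add_apply]; ring

theorem tanip_smul_right (c : ℝ) (u v : Fin 3 → ℝ) : tanip u (c • v) = c * tanip u v := by
  simp only [tanip_eq, Pi.smul_apply, smul_eq_mul]; ring

theorem tanip_smul_left (c : ℝ) (u v : Fin 3 → ℝ) : tanip (c • u) v = c * tanip u v := by
  simp only [tanip_eq, Pi.smul_apply, smul_eq_mul]; ring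

theorem exists_eq_smul_of_lcross_eq_zero {a b : Fin 3 → ℝ} (h : lcross a b = 0) (hb : b ≠ 0) :
    ∃ t : ℝ, a = t • b := by
  have h0 := congrFun h 0
  have h1 := congrFun h 1
  have h2 := congrFun h 2
  rw [lcross_apply_zero] at h0
  rw [lcross_apply_one] at h1
  rw [lcross_apply_two] at h2
  simp only [Pi.zero_apply] at h0 h1 h2
  obtain ⟨i, hi⟩ := Function.ne_iff.1 hb
  simp only [Pi.zero_apply] at hi
  refine ⟨a i / b i, ?_⟩
  ext j
  rw [Pi.smul_apply, smul_eq_mul, div_mul_eq_mul_div, eq_div_iff hi]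
  fin_cases i <;> fin_cases j <;> simp <;> linarith

theorem lcross_orthogonal {d u w : Fin 3 → ℝ} (hu : tanip d u = 0) (hw : tanip d w = 0) :
    lcross d (lcross u w) = 0 := by
  rw [tanip_eq] at hu hw
  ext i
  fin_cases i
  · simp [lcross_apply_zero, lcross_apply_one, lcross_apply_two]
    linear_combination (w 0) * hu - u 0 * hw
  · simp [lcross_apply_zero, lcross_apply_one, lcross_apply_two]
    linear_combination (w 1) * hu - u 1 * hw
  · simp [lcross_apply_zero, lcross_apply_one, lcross_apply_two]
    linear_combination (w 2) * hu - u 2 * hw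

theorem eq_smul_lcross {d u w : Fin 3 → ℝ} (hu : tanip d u = 0) (hw : tanip d w = 0)
    (h : lcross u w ≠ 0) : ∃ t : ℝ, d = t • lcross u w :=
  exists_eq_smul_of_lcross_eq_zero (lcross_orthogonal hu hw) h

theorem lcross_ne_zero_of_tanip_ne_zero {u w x : Fin 3 → ℝ} (h : tanip (lcross u w) x ≠ 0) :
    lcross u w ≠ 0 := by
  intro h0
  apply h
  rw [h0, tanip_eq]
  simp

/-- A vector is determined by its norm and its products with `u`, `w`, and `u × w`, provided that
the last one is not zero. -/
theorem eq_of_tanip_eq {u w x y : Fin 3 → ℝ} (hu : tanip u x = tanip u y)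
    (hw : tanip w x = tanip w y) (huw : tanip (lcross u w) x = tanip (lcross u w) y)
    (hne : tanip (lcross u w) x ≠ 0) (hxx : tanip x x = tanip y y) : x = y := by
  have hν := lcross_ne_zero_of_tanip_ne_zero hne
  have e1 : tanip (y - x) u = 0 := by
    simp only [tanip_eq, Pi.sub_apply] at *; linarith
  have e2 : tanip (y - x) w = 0 := by
    simp only [tanip_eq, Pi.sub_apply] at *; linarith
  obtain ⟨t, ht⟩ := eq_smul_lcross e1 e2 hν
  have hy : y = x + t • lcross u w := by rw [← ht]; abel
  -- If `u × w` is non-null this already gives `t = 0`. If it is null, equality of the norms is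
  -- needed: its remaining term is linear in `t`, with the nonzero factor `⟨u × w, x⟩`.
  have h1 : t * tanip (lcross u w) (lcross u w) = 0 := by
    rw [hy, tanip_add_right, tanip_smul_right] at huw; linarith
  have h2 : 2 * t * tanip (lcross u w) x + t * (t * tanip (lcross u w) (lcross u w)) = 0 := by
    rw [hy] at hxx
    simp only [tanip_eq, Pi.add_apply, Pi.smul_apply, smul_eq_mul] at hxx ⊢
    linarith
  rw [h1, mul_zero, add_zero] at h2
  have ht0 : t = 0 := by simpa [hne] using h2
  rw [hy, ht0]; simp

/-- Membership in `SO(1,2)`. -/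
def IsSO (B : Matrix (Fin 3) (Fin 3) ℝ) : Prop := Bᵀ * etaT * B = etaT ∧ B.det = 1

theorem IsSO.tanip {B : Matrix (Fin 3) (Fin 3) ℝ} (hB : IsSO B) (u w : Fin 3 → ℝ) :
    tanip (B *ᵥ u) (B *ᵥ w) = tanip u w := by
  unfold HolMink.tanip
  rw [← vecMul_transpose, ← dotProduct_mulVec, mulVec_mulVec, mulVec_mulVec, hB.1]

theorem IsSO.tanip_lcross {B : Matrix (Fin 3) (Fin 3) ℝ} (hB : IsSO B) (u v w : Fin 3 → ℝ) :
    HolMink.tanip (lcross (B *ᵥ u) (B *ᵥ v)) (B *ᵥ w) = HolMink.tanip (lcross u v) w := by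
  have h : Matrix.of ![B *ᵥ u, B *ᵥ v, B *ᵥ w] = Matrix.of ![u, v, w] * Bᵀ := by
    ext i j
    fin_cases i <;> simp [Matrix.mul_apply, mulVec, dotProduct, mul_comm]
  rw [HolMink.tanip_lcross, HolMink.tanip_lcross, h, det_mul, det_transpose, hB.2, mul_one]

theorem eq_of_mulVec_eq {A B : Matrix (Fin 3) (Fin 3) ℝ} (h : ∀ z, A *ᵥ z = B *ᵥ z) : A = B := by
  ext i j
  simpa using congrFun (h (Pi.single j 1)) i

/-- An element of `SO(1,2)` is determined by its values on two independent vectors. -/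
theorem IsSO.eq_of_mulVec_eq {A B : Matrix (Fin 3) (Fin 3) ℝ} (hA : IsSO A) (hB : IsSO B)
    {u w : Fin 3 → ℝ} (hu : A *ᵥ u = B *ᵥ u) (hw : A *ᵥ w = B *ᵥ w) (huw : lcross u w ≠ 0) :
    A = B := by
  have key : ∀ z, HolMink.tanip (lcross u w) z ≠ 0 → A *ᵥ z = B *ᵥ z := by
    intro z hz
    refine eq_of_tanip_eq (u := A *ᵥ u) (w := A *ᵥ w) ?_ ?_ ?_ ?_ ?_
    · rw [hA.tanip, hu, hB.tanip]
    · rw [hA.tanip, hw, hB.tanip]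
    · rw [hA.tanip_lcross, hu, hw, hB.tanip_lcross]
    · rwa [hA.tanip_lcross]
    · rw [hA.tanip, hB.tanip]
  obtain ⟨z₀, hz₀⟩ : ∃ z, HolMink.tanip (lcross u w) z ≠ 0 := by
    by_contra! h
    apply huw
    have h0 := h (Pi.single 0 1)
    have h1 := h (Pi.single 1 1)
    have h2 := h (Pi.single 2 1)
    simp [tanip_eq] at h0 h1 h2
    ext i; fin_cases i <;> simpa
  refine HolMink.eq_of_mulVec_eq fun z => ?_
  by_cases hz : HolMink.tanip (lcross u w) z = 0
  -- A vector in the plane of `u` and `w` is the difference of `z + z₀` and `z₀`, both off the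
  -- plane.
  · have h := key (z + z₀) (by rwa [tanip_add_right, hz, zero_add])
    rw [mulVec_add, mulVec_add, key z₀ hz₀] at h
    exact add_right_cancel h
  · exact key z hz

theorem isSO_one : IsSO 1 := by simp [IsSO]

/-- A nontrivial element of `SO(1,2)` fixes at most one line. -/
theorem IsSO.exists_eq_smul {A : Matrix (Fin 3) (Fin 3) ℝ} (hA : IsSO A) (hA1 : A ≠ 1)
    {x y : Fin 3 → ℝ} (hx : A *ᵥ x = x) (hy : A *ᵥ y = y) (hy0 : y ≠ 0) : ∃ t : ℝ, x = t • y := by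
  refine exists_eq_smul_of_lcross_eq_zero ?_ hy0
  by_contra h
  exact hA1 (hA.eq_of_mulVec_eq isSO_one (by rw [hx, one_mulVec]) (by rw [hy, one_mulVec]) h)

/-- A Gram determinant is the squared coordinate determinant times `det etaT = -1`. -/
theorem det_gram_three (a b c : Fin 3 → ℝ) :
    (Matrix.of ![![tanip a a, tanip a b, tanip a c], ![tanip b a, tanip b b, tanip b c],
      ![tanip c a, tanip c b, tanip c c]]).det = -tanip (lcross a b) c ^ 2 := by
  rw [det_fin_three]
  simp [tanip_eq, lcross_apply_zero, lcross_apply_one, lcross_apply_two]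
  ring

/-- A null vector in the plane of `a` and `b` which is orthogonal to `a` and `b` does not separate
the two sides of this plane. -/
theorem not_neg_of_orthogonal {a b x y u : Fin 3 → ℝ}
    (h : tanip (lcross a b) x * tanip (lcross a b) y < 0) (ha : tanip u a = 0)
    (hb : tanip u b = 0) : ¬(tanip u x < 0 ∧ tanip u y < 0) := by
  rintro ⟨hx, hy⟩
  obtain ⟨t, rfl⟩ := eq_smul_lcross ha hb
    (lcross_ne_zero_of_tanip_ne_zero (left_ne_zero_of_mul h.ne))
  rw [tanip_smul_left] at hx hy
  nlinarith [mul_pos_of_neg_of_neg hx hy, mul_nonneg (mul_self_nonneg t) (neg_nonneg.2 h.le)]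

/-! ### Normal representatives -/

theorem crossMatrix_mulVec (u w : Fin 3 → ℝ) : crossMatrix u *ᵥ w = lcross u w := by
  ext i
  fin_cases i <;>
    simp [crossMatrix, mulVec, dotProduct, Fin.sum_univ_three, lcross_apply_zero, lcross_apply_one,
      lcross_apply_two] <;> ring

/-- The cube of `crossMatrix n` is a multiple of `⟨n,n⟩ crossMatrix n`, so for null `n` the
exponential series stops after the quadratic term. -/
theorem exp_crossMatrix_of_null {n : Fin 3 → ℝ} (hn : tanip n n = 0) :
    NormedSpace.exp (crossMatrix n) =
      1 + crossMatrix n + (2⁻¹ : ℝ) • (crossMatrix n * crossMatrix n) := by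
  rw [tanip_eq] at hn
  have h3 : crossMatrix n ^ 3 = 0 := by
    rw [pow_succ, pow_two]
    ext i j
    fin_cases i <;> fin_cases j <;>
      simp [crossMatrix, Matrix.mul_apply, Fin.sum_univ_three, lcross_apply_zero,
        lcross_apply_one, lcross_apply_two]
    · ring
    · linear_combination (n 2) * hn
    · linear_combination (-n 1) * hn
    · linear_combination (n 2) * hn
    · ring
    · linear_combination (-n 0) * hn
    · linear_combination (-n 1) * hn
    · linear_combination (n 0) * hn
    · ring
  rw [NormedSpace.exp_eq_tsum ℝ]
  simp only
  rw [tsum_eq_sum (s := Finset.range 3)]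
  · simp [Finset.sum_range_succ, pow_two]
  · intro k hk
    obtain ⟨l, rfl⟩ := Nat.exists_eq_add_of_le (not_lt.1 (Finset.mem_range.not.1 hk))
    rw [pow_add, h3, zero_mul, smul_zero]

theorem IsNormalRepresentative.spec {O : Matrix (Fin 3) (Fin 3) ℝ} {n : Fin 3 → ℝ}
    (h : IsNormalRepresentative O n) (hO : O ≠ 1) :
    O *ᵥ n = n ∧ n ≠ 0 ∧ (tanip n n = 0 → IsParabolicHolonomy O) := by
  rcases h with ⟨h1, h2⟩ | ⟨h1, h2⟩
  · refine ⟨h2, ?_, fun h => ?_⟩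
    · rintro rfl
      simp [tanip_eq] at h1
    · rw [h] at h1; norm_num at h1
  · rw [exp_crossMatrix_of_null h1] at h2
    have h3 : crossMatrix n *ᵥ n = 0 := by
      rw [crossMatrix_mulVec]
      ext i
      fin_cases i <;> simp [lcross_apply_zero, lcross_apply_one, lcross_apply_two] <;> ring
    refine ⟨?_, ?_, fun _ => ⟨hO, ?_⟩⟩
    · rw [h2, add_mulVec, add_mulVec, smul_mulVec, ← mulVec_mulVec, h3]
      simp
    · rintro rfl
      apply hO
      have : crossMatrix 0 = 0 := by
        ext i j; fin_cases i <;>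
          simp [crossMatrix, lcross_apply_zero, lcross_apply_one, lcross_apply_two]
      rw [h2, this]; simp
    -- `crossMatrix n` is traceless and the trace of its square is a multiple of `⟨n,n⟩`, so the
    -- trace is that of the identity.
    · rw [h2]
      rw [tanip_eq] at h1
      simp [Matrix.trace_fin_three, crossMatrix, Matrix.mul_apply, Fin.sum_univ_three,
        lcross_apply_zero, lcross_apply_one, lcross_apply_two]
      linarith

/-! ### Holonomy data -/

/-- Elements of `SO(1,2)` with trivial ordered product, and vectors fixed by them. -/
structure IsHolonomyData (O : Fin 4 → Matrix (Fin 3) (Fin 3) ℝ) (m : Fin 4 → Fin 3 → ℝ) :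
    Prop where
  isSO : ∀ i, IsSO (O i)
  fixes : ∀ i, O i *ᵥ m i = m i
  closure : O 3 * O 2 * O 1 * O 0 = 1

theorem chi_zero (O : Fin 4 → Matrix (Fin 3) (Fin 3) ℝ) (m : Fin 4 → Fin 3 → ℝ) :
    chi O m 0 = tanip (lcross (m 2) (m 1)) ((O 2)⁻¹ *ᵥ m 3) := rfl
theorem chi_one (O : Fin 4 → Matrix (Fin 3) (Fin 3) ℝ) (m : Fin 4 → Fin 3 → ℝ) :
    chi O m 1 = tanip (lcross (m 0) (m 2)) (m 3) := rfl
theorem chi_two (O : Fin 4 → Matrix (Fin 3) (Fin 3) ℝ) (m : Fin 4 → Fin 3 → ℝ) :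
    chi O m 2 = tanip (lcross (m 1) (m 0)) (O 0 *ᵥ m 3) := rfl
theorem chi_three (O : Fin 4 → Matrix (Fin 3) (Fin 3) ℝ) (m : Fin 4 → Fin 3 → ℝ) :
    chi O m 3 = tanip (lcross (m 0) (m 1)) (m 2) := rfl

theorem faceGram_one_three (O : Fin 4 → Matrix (Fin 3) (Fin 3) ℝ) (m : Fin 4 → Fin 3 → ℝ) :
    faceGram O m 1 3 = tanip (m 1) (O 0 *ᵥ m 3) := rfl
theorem faceGram_three_one (O : Fin 4 → Matrix (Fin 3) (Fin 3) ℝ) (m : Fin 4 → Fin 3 → ℝ) :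
    faceGram O m 3 1 = tanip (m 1) (O 0 *ᵥ m 3) := rfl

theorem faceGram_apply (O : Fin 4 → Matrix (Fin 3) (Fin 3) ℝ) (m : Fin 4 → Fin 3 → ℝ) {i j : Fin 4}
    (h : ¬((i = 1 ∧ j = 3) ∨ (i = 3 ∧ j = 1))) : faceGram O m i j = tanip (m i) (m j) := if_neg h

theorem faceGram_symm (O : Fin 4 → Matrix (Fin 3) (Fin 3) ℝ) (m : Fin 4 → Fin 3 → ℝ) (i j : Fin 4) :
    faceGram O m i j = faceGram O m j i := by
  by_cases h : (i = 1 ∧ j = 3) ∨ (i = 3 ∧ j = 1)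
  · rcases h with ⟨rfl, rfl⟩ | ⟨rfl, rfl⟩ <;> rfl
  · rw [faceGram_apply O m h, faceGram_apply O m (by tauto), tanip_comm]

theorem tanip_lcross_swap (a b c : Fin 3 → ℝ) :
    tanip (lcross b a) c = -tanip (lcross a b) c := by
  simp only [tanip_eq, lcross_apply_zero, lcross_apply_one, lcross_apply_two]; ring

theorem tanip_lcross_swap_right (a b c : Fin 3 → ℝ) :
    tanip (lcross a c) b = -tanip (lcross a b) c := by
  simp only [tanip_eq, lcross_apply_zero, lcross_apply_one, lcross_apply_two]; ring

theorem tanip_lcross_cycle (a b c : Fin 3 → ℝ) :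
    tanip (lcross b c) a = tanip (lcross a b) c := by
  simp only [tanip_eq, lcross_apply_zero, lcross_apply_one, lcross_apply_two]; ring

theorem IsSO.isUnit {B : Matrix (Fin 3) (Fin 3) ℝ} (hB : IsSO B) : IsUnit B.det := by
  rw [hB.2]; exact isUnit_one

theorem IsSO.mulVec_inv {B : Matrix (Fin 3) (Fin 3) ℝ} (hB : IsSO B) (x : Fin 3 → ℝ) :
    B *ᵥ (B⁻¹ *ᵥ x) = x := by
  rw [mulVec_mulVec, mul_nonsing_inv _ hB.isUnit, one_mulVec]

theorem IsSO.inv_mulVec {B : Matrix (Fin 3) (Fin 3) ℝ} (hB : IsSO B) (x : Fin 3 → ℝ) :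
    B⁻¹ *ᵥ (B *ᵥ x) = x := by
  rw [mulVec_mulVec, nonsing_inv_mul _ hB.isUnit, one_mulVec]

theorem IsSO.tanip_inv {B : Matrix (Fin 3) (Fin 3) ℝ} (hB : IsSO B) (x y : Fin 3 → ℝ) :
    HolMink.tanip x (B⁻¹ *ᵥ y) = HolMink.tanip (B *ᵥ x) y := by
  rw [← hB.tanip, hB.mulVec_inv]

theorem IsSO.tanip_lcross_inv {B : Matrix (Fin 3) (Fin 3) ℝ} (hB : IsSO B) (x y z : Fin 3 → ℝ) :
    HolMink.tanip (lcross x y) (B⁻¹ *ᵥ z) = HolMink.tanip (lcross (B *ᵥ x) (B *ᵥ y)) z := by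
  rw [← hB.tanip_lcross, hB.mulVec_inv]

/-! ### Principal minors, rigidity, and a sign obstruction for holonomy data -/

namespace IsHolonomyData
variable {O : Fin 4 → Matrix (Fin 3) (Fin 3) ℝ} {m : Fin 4 → Fin 3 → ℝ} (h : IsHolonomyData O m)
include h

/-- Closure, applied to the vector fixed by `O 3`. In a tetrahedron `m 3`, `O 0 *ᵥ m 3` and `(O 2)⁻¹
*ᵥ m 3` are the fourth normal carried to the base from the vertices with indices 1, 2 and 0. -/
theorem mulVec_mulVec_three : O 1 *ᵥ (O 0 *ᵥ m 3) = (O 2)⁻¹ *ᵥ m 3 := by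
  have h1 : O 3 *ᵥ (O 2 *ᵥ (O 1 *ᵥ (O 0 *ᵥ m 3))) = m 3 := by
    simp only [mulVec_mulVec, ← Matrix.mul_assoc]
    rw [h.closure, one_mulVec]
  have h2 := congrArg (fun x => (O 3)⁻¹ *ᵥ x) h1
  simp only [(h.isSO 3).inv_mulVec] at h2
  rw [← (h.isSO 2).inv_mulVec (O 1 *ᵥ (O 0 *ᵥ m 3)), h2]
  congr 1
  conv_lhs => rw [← h.fixes 3]
  exact (h.isSO 3).inv_mulVec _

theorem tanip_zero_three : tanip (m 0) (O 0 *ᵥ m 3) = faceGram O m 0 3 := by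
  rw [faceGram_apply O m (by decide)]
  conv_lhs => rw [← h.fixes 0]
  exact (h.isSO 0).tanip _ _

theorem tanip_two_three : tanip (m 2) ((O 2)⁻¹ *ᵥ m 3) = faceGram O m 2 3 := by
  rw [(h.isSO 2).tanip_inv, h.fixes 2, faceGram_apply O m (by decide)]

theorem tanip_one_three : tanip (m 1) ((O 2)⁻¹ *ᵥ m 3) = faceGram O m 1 3 := by
  rw [faceGram_one_three, ← h.mulVec_mulVec_three]
  conv_lhs => rw [← h.fixes 1]
  exact (h.isSO 1).tanip _ _

theorem tanip_mulVec_three : tanip (O 0 *ᵥ m 3) (O 0 *ᵥ m 3) = faceGram O m 3 3 := by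
  rw [(h.isSO 0).tanip, faceGram_apply O m (by decide)]

theorem tanip_inv_three : tanip ((O 2)⁻¹ *ᵥ m 3) ((O 2)⁻¹ *ᵥ m 3) = faceGram O m 3 3 := by
  rw [(h.isSO 2).tanip_inv, (h.isSO 2).mulVec_inv, faceGram_apply O m (by decide)]

/-- The principal minors of the Gram matrix are the negative squares of the triple products. -/
theorem det_submatrix (i : Fin 4) :
    ((faceGram O m).submatrix i.succAbove i.succAbove).det = -chi O m i ^ 2 := by
  -- The copy of the fourth normal occurring in `χ_i`, for `i ≠ 3`, has the Gram entries as its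
  -- products with the other two normals of that triple, so the minor is a Gram determinant of three
  -- tangent vectors.
  fin_cases i
  · change ((faceGram O m).submatrix (Fin.succAbove 0) (Fin.succAbove 0)).det = -chi O m 0 ^ 2
    rw [chi_zero, tanip_lcross_swap, neg_sq, ← det_gram_three, h.tanip_one_three, h.tanip_two_three,
      h.tanip_inv_three, tanip_comm ((O 2)⁻¹ *ᵥ m 3), tanip_comm ((O 2)⁻¹ *ᵥ m 3),
      h.tanip_one_three, h.tanip_two_three]
    congr 1
    ext i j
    fin_cases i <;> fin_cases j <;> simp [faceGram, tanip_comm (m 3)]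
  · change ((faceGram O m).submatrix (Fin.succAbove 1) (Fin.succAbove 1)).det = -chi O m 1 ^ 2
    rw [chi_one, ← det_gram_three]
    congr 1
    ext i j
    fin_cases i <;> fin_cases j <;> simp [faceGram, Fin.succAbove]
  · change ((faceGram O m).submatrix (Fin.succAbove 2) (Fin.succAbove 2)).det = -chi O m 2 ^ 2
    rw [chi_two, tanip_lcross_swap, neg_sq, ← det_gram_three, h.tanip_zero_three,
      h.tanip_mulVec_three, tanip_comm (O 0 *ᵥ m 3), tanip_comm (O 0 *ᵥ m 3),
      h.tanip_zero_three]
    congr 1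
    ext i j
    fin_cases i <;> fin_cases j <;> simp [faceGram, Fin.succAbove, tanip_comm (m 3)]
  · change ((faceGram O m).submatrix (Fin.succAbove 3) (Fin.succAbove 3)).det = -chi O m 3 ^ 2
    rw [chi_three, ← det_gram_three]
    congr 1
    ext i j
    fin_cases i <;> fin_cases j <;> simp [faceGram, Fin.succAbove]

/-- The holonomies and the fourth normal are determined by the Gram matrix and the first three
normals. -/
theorem eq_of_faceGram_eq {O' : Fin 4 → Matrix (Fin 3) (Fin 3) ℝ} {m' : Fin 4 → Fin 3 → ℝ}
    (h' : IsHolonomyData O' m') (hG : faceGram O m = faceGram O' m') (hχ : ∀ i, 0 < chi O m i)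
    (hχ' : ∀ i, 0 < chi O' m' i) (hm : ∀ i, i ≠ 3 → m i = m' i) : m = m' ∧ O = O' := by
  -- The Gram matrix determines the squares, and positivity removes the sign.
  have hχeq : ∀ i, chi O m i = chi O' m' i := by
    intro i
    have h1 := h.det_submatrix i
    rw [hG, h'.det_submatrix i, neg_inj] at h1
    exact ((sq_eq_sq₀ (hχ' i).le (hχ i).le).1 h1).symm
  have hm0 := hm 0 (by decide)
  have hm1 := hm 1 (by decide)
  have hm2 := hm 2 (by decide)
  have hm3 : m 3 = m' 3 := by
    have e0 := congrFun (congrFun hG 0) 3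
    have e2 := congrFun (congrFun hG 2) 3
    have e3 := congrFun (congrFun hG 3) 3
    rw [faceGram_apply _ _ (by decide), faceGram_apply _ _ (by decide)] at e0 e2 e3
    have eχ := hχeq 1
    rw [← hm0] at e0
    rw [← hm2] at e2
    rw [chi_one, chi_one, ← hm0, ← hm2] at eχ
    exact eq_of_tanip_eq e0 e2 eχ (hχ 1).ne' e3
  have hmm : m = m' := by
    funext i
    fin_cases i <;> assumption
  subst hmm
  have hq : O 0 *ᵥ m 3 = O' 0 *ᵥ m 3 := by
    refine eq_of_tanip_eq (u := m 1) (w := m 0) ?_ ?_ (hχeq 2) (hχ 2).ne' ?_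
    · exact congrFun (congrFun hG 1) 3
    · rw [h.tanip_zero_three, h'.tanip_zero_three, hG]
    · rw [h.tanip_mulVec_three, h'.tanip_mulVec_three, hG]
  have hr : (O 2)⁻¹ *ᵥ m 3 = (O' 2)⁻¹ *ᵥ m 3 := by
    refine eq_of_tanip_eq (u := m 2) (w := m 1) ?_ ?_ (hχeq 0) (hχ 0).ne' ?_
    · rw [h.tanip_two_three, h'.tanip_two_three, hG]
    · rw [h.tanip_one_three, h'.tanip_one_three, hG]
    · rw [h.tanip_inv_three, h'.tanip_inv_three, hG]
  -- Each of the first three holonomies has known values on two independent vectors: its own normal,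
  -- and a copy of the fourth normal which it carries to another copy.
  have hO0 : O 0 = O' 0 := by
    refine (h.isSO 0).eq_of_mulVec_eq (h'.isSO 0) (by rw [h.fixes 0, h'.fixes 0]) hq
      (lcross_ne_zero_of_tanip_ne_zero (x := m 2) ?_)
    rw [tanip_lcross_swap_right, neg_ne_zero]
    exact (hχ 1).ne'
  have hO2 : O 2 = O' 2 := by
    refine (h.isSO 2).eq_of_mulVec_eq (h'.isSO 2) (by rw [h.fixes 2, h'.fixes 2])
      (w := (O 2)⁻¹ *ᵥ m 3) ?_ (lcross_ne_zero_of_tanip_ne_zero (x := m 1) ?_)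
    · rw [(h.isSO 2).mulVec_inv, hr, (h'.isSO 2).mulVec_inv]
    · rw [tanip_lcross_swap_right, neg_ne_zero]
      exact (hχ 0).ne'
  have hO1 : O 1 = O' 1 := by
    refine (h.isSO 1).eq_of_mulVec_eq (h'.isSO 1) (by rw [h.fixes 1, h'.fixes 1])
      (w := O 0 *ᵥ m 3) ?_ (lcross_ne_zero_of_tanip_ne_zero (x := m 0) ?_)
    · rw [h.mulVec_mulVec_three, hq, h'.mulVec_mulVec_three, hr]
    · rw [tanip_lcross_swap_right, neg_ne_zero]
      exact (hχ 2).ne'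
  have hO3 : O 3 = O' 3 := by
    have e := h.closure
    rw [← h'.closure, hO0, hO1, hO2] at e
    have hu : ∀ i {A B : Matrix (Fin 3) (Fin 3) ℝ}, A * O' i = B * O' i → A = B := by
      intro i A B hAB
      exact (Matrix.isUnit_iff_isUnit_det _).2 (h'.isSO i).isUnit |>.mul_right_cancel hAB
    exact hu 2 (hu 1 (hu 0 e))
  refine ⟨rfl, ?_⟩
  funext i
  fin_cases i <;> assumption

-- Common form of the six cases below: `A`, `B`, `X`, `Y` realise the Gram entries of `k`, `l`, `i`,
-- `j`, except those among `i` and `j` alone, and `X`, `Y` lie on opposite sides of the plane of `A`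
-- and `B`. The combination `α A + β B` is orthogonal to this plane.
omit h in
theorem not_neg_of_tanip_eq {i j k l : Fin 4} {A B X Y : Fin 3 → ℝ} {α β : ℝ}
    (hneg : tanip (lcross A B) X * tanip (lcross A B) Y < 0)
    (hAA : tanip A A = faceGram O m k k) (hAB : tanip A B = faceGram O m k l)
    (hBB : tanip B B = faceGram O m l l) (hAX : tanip A X = faceGram O m k i)
    (hBX : tanip B X = faceGram O m l i) (hAY : tanip A Y = faceGram O m k j)
    (hBY : tanip B Y = faceGram O m l j)
    (h1 : α * faceGram O m k k + β * faceGram O m l k = 0)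
    (h2 : α * faceGram O m k l + β * faceGram O m l l = 0) :
    ¬(α * faceGram O m k i + β * faceGram O m l i < 0 ∧
      α * faceGram O m k j + β * faceGram O m l j < 0) := by
  have hu : ∀ Z, tanip (α • A + β • B) Z = α * tanip A Z + β * tanip B Z := by
    intro Z
    rw [tanip_comm, tanip_add_right, tanip_smul_right, tanip_smul_right, tanip_comm Z, tanip_comm Z]
  have := not_neg_of_orthogonal (u := α • A + β • B) hneg
    (by rw [hu, tanip_comm B, hAA, hAB, faceGram_symm, ← h1, faceGram_symm O m l k])
    (by rw [hu, hAB, hBB, h2])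
  rwa [hu, hu, hAX, hBX, hAY, hBY] at this

/-- If a combination of two rows of the Gram matrix has zero entries at these two places, then its
entries at the other two places are not both negative. -/
theorem not_neg_of_faceGram (hχ : ∀ i, 0 < chi O m i) {i j : Fin 4} (hij : i ≠ j) (a : Fin 4 → ℝ)
    (hi : a i = 0) (hj : a j = 0)
    (ha : ∀ k, k ≠ i → k ≠ j → ∑ l, a l * faceGram O m l k = 0) :
    ¬(∑ l, a l * faceGram O m l i < 0 ∧ ∑ l, a l * faceGram O m l j < 0) := by
  wlog hlt : i < j generalizing i j
  · rw [and_comm]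
    exact this hij.symm hj hi (fun k h1 h2 => ha k h2 h1) (lt_of_le_of_ne (not_lt.1 hlt) hij.symm)
  have hχ0 := hχ 0
  have hχ1 := hχ 1
  have hχ2 := hχ 2
  have hχ3 := hχ 3
  rw [chi_zero] at hχ0
  rw [chi_one] at hχ1
  rw [chi_two] at hχ2
  rw [chi_three] at hχ3
  have g : ∀ {i j : Fin 4}, ¬((i = 1 ∧ j = 3) ∨ (i = 3 ∧ j = 1)) →
    tanip (m i) (m j) = faceGram O m i j := fun h => (faceGram_apply O m h).symm
  simp only [Fin.sum_univ_four] at ha ⊢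
  -- In every case the vectors are moved by holonomies until all required products are Gram entries.
  -- Up to opposite signs, the triple products of `A`, `B` with `X` and with `Y` are then `χ_j` and
  -- `χ_i`.
  fin_cases i <;> fin_cases j <;> first | exact absurd hlt (by decide) | skip
  · change a 0 = 0 at hi
    change a 1 = 0 at hj
    have h1 := ha 2 (by decide) (by decide)
    have h2 := ha 3 (by decide) (by decide)
    rw [hi, hj] at h1 h2
    have := not_neg_of_tanip_eq (O := O) (m := m) (i := 0) (j := 1) (k := 2) (l := 3)
      (A := m 2) (B := (O 2)⁻¹ *ᵥ m 3) (X := (O 2)⁻¹ *ᵥ m 0) (Y := m 1) (α := a 2) (β := a 3) (by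
        rw [(h.isSO 2).tanip_lcross_inv, h.fixes 2, (h.isSO 2).mulVec_inv,
          tanip_lcross_swap_right _ (m 1), tanip_lcross_cycle]
        nlinarith)
      (g (by decide)) (h.tanip_two_three) (h.tanip_inv_three)
      (by rw [(h.isSO 2).tanip_inv, h.fixes 2, g (by decide)])
      (by rw [(h.isSO 2).tanip_inv, (h.isSO 2).mulVec_inv, g (by decide)])
      (g (by decide))
      (by rw [tanip_comm, h.tanip_one_three, faceGram_symm])
      (by linarith) (by linarith)
    simpa [hi, hj] using this
  · change a 0 = 0 at hi
    change a 2 = 0 at hj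
    have h1 := ha 1 (by decide) (by decide)
    have h2 := ha 3 (by decide) (by decide)
    rw [hi, hj] at h1 h2
    have := not_neg_of_tanip_eq (O := O) (m := m) (i := 0) (j := 2) (k := 1) (l := 3)
      (A := m 1) (B := O 0 *ᵥ m 3) (X := m 0) (Y := (O 1)⁻¹ *ᵥ m 2) (α := a 1) (β := a 3) (by
        rw [(h.isSO 1).tanip_lcross_inv, h.fixes 1, h.mulVec_mulVec_three,
          tanip_lcross_swap_right _ (m 0), tanip_lcross_swap_right _ (m 2),
          tanip_lcross_swap (m 2)]
        nlinarith)
      (g (by decide)) (rfl) (h.tanip_mulVec_three)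
      (g (by decide))
      (by rw [tanip_comm, h.tanip_zero_three, faceGram_symm])
      (by rw [(h.isSO 1).tanip_inv, h.fixes 1, g (by decide)])
      (by rw [(h.isSO 1).tanip_inv, h.mulVec_mulVec_three, tanip_comm, h.tanip_two_three,
        faceGram_symm])
      (by linarith) (by linarith)
    simpa [hi, hj] using this
  · change a 0 = 0 at hi
    change a 3 = 0 at hj
    have h1 := ha 1 (by decide) (by decide)
    have h2 := ha 2 (by decide) (by decide)
    rw [hi, hj] at h1 h2
    have := not_neg_of_tanip_eq (O := O) (m := m) (i := 0) (j := 3) (k := 1) (l := 2)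
      (A := m 1) (B := m 2) (X := m 0) (Y := (O 2)⁻¹ *ᵥ m 3) (α := a 1) (β := a 2) (by
        rw [tanip_lcross_cycle, tanip_lcross_swap (m 2) (m 1)]
        nlinarith)
      (g (by decide)) (g (by decide)) (g (by decide))
      (g (by decide))
      (g (by decide))
      (h.tanip_one_three)
      (h.tanip_two_three)
      (by linarith) (by linarith)
    simpa [hi, hj] using this
  · change a 1 = 0 at hi
    change a 2 = 0 at hj
    have h1 := ha 0 (by decide) (by decide)
    have h2 := ha 3 (by decide) (by decide)
    rw [hi, hj] at h1 h2
    have := not_neg_of_tanip_eq (O := O) (m := m) (i := 1) (j := 2) (k := 0) (l := 3)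
      (A := m 0) (B := m 3) (X := (O 0)⁻¹ *ᵥ m 1) (Y := m 2) (α := a 0) (β := a 3) (by
        rw [(h.isSO 0).tanip_lcross_inv, h.fixes 0, tanip_lcross_swap_right _ (m 1),
          tanip_lcross_swap_right _ (m 2), tanip_lcross_swap (m 1)]
        nlinarith)
      (g (by decide)) (g (by decide)) (g (by decide))
      (by rw [(h.isSO 0).tanip_inv, h.fixes 0, g (by decide)])
      (by rw [(h.isSO 0).tanip_inv, tanip_comm, faceGram_three_one])
      (g (by decide))
      (g (by decide))
      (by linarith) (by linarith)
    simpa [hi, hj] using this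
  · change a 1 = 0 at hi
    change a 3 = 0 at hj
    have h1 := ha 0 (by decide) (by decide)
    have h2 := ha 2 (by decide) (by decide)
    rw [hi, hj] at h1 h2
    have := not_neg_of_tanip_eq (O := O) (m := m) (i := 1) (j := 3) (k := 0) (l := 2)
      (A := m 0) (B := m 2) (X := m 1) (Y := m 3) (α := a 0) (β := a 2) (by
        rw [tanip_lcross_swap_right]
        nlinarith)
      (g (by decide)) (g (by decide)) (g (by decide))
      (g (by decide))
      (g (by decide))
      (g (by decide))
      (g (by decide))
      (by linarith) (by linarith)
    simpa [hi, hj] using this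
  · change a 2 = 0 at hi
    change a 3 = 0 at hj
    have h1 := ha 0 (by decide) (by decide)
    have h2 := ha 1 (by decide) (by decide)
    rw [hi, hj] at h1 h2
    have := not_neg_of_tanip_eq (O := O) (m := m) (i := 2) (j := 3) (k := 0) (l := 1)
      (A := m 0) (B := m 1) (X := m 2) (Y := O 0 *ᵥ m 3) (α := a 0) (β := a 1) (by
        rw [tanip_lcross_swap (m 1) (m 0) (O 0 *ᵥ m 3)]
        nlinarith)
      (g (by decide)) (g (by decide)) (g (by decide))
      (g (by decide))
      (g (by decide))
      (h.tanip_zero_three)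
      (rfl)
      (by linarith) (by linarith)
    simpa [hi, hj] using this

end IsHolonomyData

/-! ### Frames -/

theorem det_four (x y z w : Fin 4 → ℝ) : (Matrix.of ![x, y, z, w]).det =
    x 0 * (y 1 * (z 2 * w 3 - z 3 * w 2) - y 2 * (z 1 * w 3 - z 3 * w 1) +
      y 3 * (z 1 * w 2 - z 2 * w 1)) -
    x 1 * (y 0 * (z 2 * w 3 - z 3 * w 2) - y 2 * (z 0 * w 3 - z 3 * w 0) +
      y 3 * (z 0 * w 2 - z 2 * w 0)) +
    x 2 * (y 0 * (z 1 * w 3 - z 3 * w 1) - y 1 * (z 0 * w 3 - z 3 * w 0) +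
      y 3 * (z 0 * w 1 - z 1 * w 0)) -
    x 3 * (y 0 * (z 1 * w 2 - z 2 * w 1) - y 1 * (z 0 * w 2 - z 2 * w 0) +
      y 2 * (z 0 * w 1 - z 1 * w 0)) := by
  rw [det_succ_row_zero, Fin.sum_univ_four]
  simp [det_fin_three, Fin.succAbove]
  ring

/-- The tangent vector with coordinates `x` in the frame `E`. -/
def frameVec {σ : Model} {p : Fin 4 → ℝ} (E : Fin 3 → tangent σ p) (x : Fin 3 → ℝ) : Fin 4 → ℝ :=
  ∑ a, x a • (E a : Fin 4 → ℝ)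

theorem coe_sum_smul {σ : Model} {p : Fin 4 → ℝ} (E : Fin 3 → tangent σ p) (x : Fin 3 → ℝ) :
    ((∑ a, x a • E a : tangent σ p) : Fin 4 → ℝ) = frameVec E x := by
  simp [frameVec]

theorem frameVec_mem {σ : Model} {p : Fin 4 → ℝ} (E : Fin 3 → tangent σ p) (x : Fin 3 → ℝ) :
    ambip σ (frameVec E x) p = 0 := by
  rw [← coe_sum_smul]; exact (∑ a, x a • E a : tangent σ p).2

section
variable {σ : Model} {p : Fin 4 → ℝ} {E : Fin 3 → tangent σ p} (hE : IsFrame σ p E)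
include hE

theorem ambip_frameVec (x y : Fin 3 → ℝ) :
    ambip σ (frameVec E x) (frameVec E y) = tanip x y := by
  simp only [frameVec, Fin.sum_univ_three, ambip_add_left, ambip_add_right, ambip_smul_left,
    ambip_smul_right, hE.orthonormal, tanip_eq]
  simp [etaT]
  ring

theorem frameVec_injective {x y : Fin 3 → ℝ} (h : frameVec E x = frameVec E y) : x = y := by
  have key : ∀ z, tanip x z = tanip y z := fun z => by
    rw [← ambip_frameVec hE, ← ambip_frameVec hE, h]
  have h0 := key (Pi.single 0 1)
  have h1 := key (Pi.single 1 1)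
  have h2 := key (Pi.single 2 1)
  simp [tanip_eq] at h0 h1 h2
  ext i; fin_cases i <;> assumption

theorem exists_frameVec {v : Fin 4 → ℝ} (hv : ambip σ v p = 0) : ∃ x, v = frameVec E x := by
  have hli := linearIndependent_of_det_ne_zero hE.oriented.ne'
  refine ⟨![-ambip σ v (E 0), ambip σ v (E 1), ambip σ v (E 2)], ?_⟩
  rw [← sub_eq_zero]
  refine eq_zero_of_orthogonal (σ := σ) hli fun i => ?_
  fin_cases i
  · change ambip σ _ p = 0
    rw [ambip_sub_left, hv, frameVec_mem, sub_zero]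
  · change ambip σ _ (E 0) = 0
    simp [frameVec, Fin.sum_univ_three, ambip_add_left, ambip_sub_left, ambip_smul_left,
      hE.orthonormal, ambip_neg_left, etaT]
  · change ambip σ _ (E 1) = 0
    simp [frameVec, Fin.sum_univ_three, ambip_add_left, ambip_sub_left, ambip_smul_left,
      hE.orthonormal, ambip_neg_left, etaT]
  · change ambip σ _ (E 2) = 0
    simp [frameVec, Fin.sum_univ_three, ambip_add_left, ambip_sub_left, ambip_smul_left,
      hE.orthonormal, ambip_neg_left, etaT]

omit hE in
theorem det_frameVec (x y z : Fin 3 → ℝ) :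
    (Matrix.of ![p, frameVec E x, frameVec E y, frameVec E z]).det =
      tanip (lcross x y) z *
        (Matrix.of ![p, (E 0 : Fin 4 → ℝ), (E 1 : Fin 4 → ℝ), (E 2 : Fin 4 → ℝ)]).det := by
  have h : Matrix.of ![p, frameVec E x, frameVec E y, frameVec E z] =
      Matrix.of ![![1, 0, 0, 0], ![0, x 0, x 1, x 2], ![0, y 0, y 1, y 2], ![0, z 0, z 1, z 2]] *
        Matrix.of ![p, (E 0 : Fin 4 → ℝ), (E 1 : Fin 4 → ℝ), (E 2 : Fin 4 → ℝ)] := by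
    ext i j
    fin_cases i <;> simp [Matrix.mul_apply, Fin.sum_univ_succ, frameVec]
  rw [h, det_mul]
  congr 1
  rw [tanip_lcross, det_succ_row_zero]
  simp [Fin.sum_univ_succ, det_fin_three]

end

/-! ### Vertices dual to the normals -/

/-- `V` consists of points of `M_σ` dual, up to negative factors, to the vectors `N`. -/
structure IsVertexDual (σ : Model) (N V : Fin 4 → Fin 4 → ℝ) : Prop where
  mem : ∀ i, V i ∈ space σ
  orthogonal : ∀ i j, j ≠ i → ambip σ (V i) (N j) = 0
  neg : ∀ i, ambip σ (V i) (N i) < 0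

section
variable {σ : Model} {N V : Fin 4 → Fin 4 → ℝ} (hD : IsVertexDual σ N V)
include hD

theorem IsVertexDual.ambip_sum (c : Fin 4 → ℝ) (i : Fin 4) :
    ambip σ (V i) (∑ j, c j • N j) = c i * ambip σ (V i) (N i) := by
  have hl : ∀ s : Finset (Fin 4), ambip σ (V i) (∑ j ∈ s, c j • N j) =
      ∑ j ∈ s, c j * ambip σ (V i) (N j) := by
    intro s
    induction s using Finset.induction_on with
    | empty => simp [ambip_zero_right]
    | insert a s ha ih => rw [Finset.sum_insert ha, Finset.sum_insert ha, ambip_add_right,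
        ambip_smul_right, ih]
  rw [hl, Finset.sum_eq_single i]
  · intro j _ hj; rw [hD.orthogonal i j hj, mul_zero]
  · simp

theorem IsVertexDual.linearIndependent : LinearIndependent ℝ N := by
  rw [Fintype.linearIndependent_iff]
  intro c hc i
  have h := hD.ambip_sum c i
  rw [hc, ambip_zero_right] at h
  exact (mul_eq_zero.1 h.symm).resolve_right (hD.neg i).ne

theorem IsVertexDual.det_ne_zero : (Matrix.of N).det ≠ 0 := by
  have h : LinearIndependent ℝ (Matrix.of N).row := hD.linearIndependent
  exact ((Matrix.isUnit_iff_isUnit_det _).1 (Matrix.linearIndependent_rows_iff_isUnit.1 h)).ne_zero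

/-- Pairing `V i` with its own expansion leaves `a i * ⟨V i, N i⟩ = σ`. This sign is the source of
the common sign of the triple products. -/
theorem IsVertexDual.exists_eq_sum (i : Fin 4) :
    ∃ a : Fin 4 → ℝ, V i = ∑ k, a k • N k ∧ σ.sgn * a i < 0 := by
  have hspan : V i ∈ Submodule.span ℝ (Set.range N) := by
    rw [hD.linearIndependent.span_eq_top_of_card_eq_finrank' (by simp)]; trivial
  obtain ⟨a, ha⟩ := (Submodule.mem_span_range_iff_exists_fun ℝ).1 hspan
  refine ⟨a, ha.symm, ?_⟩
  have h := hD.ambip_sum a i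
  rw [ha, mem_space.1 (hD.mem i)] at h
  have h2 : (σ.sgn * a i) * ambip σ (V i) (N i) = 1 := by
    rw [mul_assoc, ← h, σ.sgn_mul_self]
  nlinarith [hD.neg i]

end

/-! ### The holonomy data of a tetrahedron -/

/-- The ambient reflection which induces the transport from `V b` to `V a`. -/
def transportMap (σ : Model) (V : Fin 4 → Fin 4 → ℝ) (a b : Fin 4) :
    (Fin 4 → ℝ) →ₗ[ℝ] (Fin 4 → ℝ) := edgeMap σ (V b) (V a)

/-- The products of reflections which induce the face holonomies. -/
def ambientHolonomy (σ : Model) (V : Fin 4 → Fin 4 → ℝ) (i : Fin 4) (v : Fin 4 → ℝ) : Fin 4 → ℝ :=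
  (![transportMap σ V 3 2 (transportMap σ V 2 1 (transportMap σ V 1 3 v)),
    transportMap σ V 3 0 (transportMap σ V 0 2 (transportMap σ V 2 3 v)),
    transportMap σ V 3 1 (transportMap σ V 1 0 (transportMap σ V 0 3 v)),
    transportMap σ V 3 1 (transportMap σ V 1 2 (transportMap σ V 2 0 (transportMap σ V 0 1
      (transportMap σ V 1 3 v))))] : Fin 4 → Fin 4 → ℝ) i

theorem IsSO.of_tanip {B : Matrix (Fin 3) (Fin 3) ℝ}
    (h : ∀ x y, HolMink.tanip (B *ᵥ x) (B *ᵥ y) = HolMink.tanip x y)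
    (h' : ∀ x y z, HolMink.tanip (lcross (B *ᵥ x) (B *ᵥ y)) (B *ᵥ z) = HolMink.tanip (lcross x y) z) :
    IsSO B := by
  constructor
  · ext i j
    have := h (Pi.single i 1) (Pi.single j 1)
    simp only [HolMink.tanip] at this
    rw [← vecMul_transpose, ← dotProduct_mulVec, mulVec_mulVec, mulVec_mulVec] at this
    simpa using this
  · have := h' (Pi.single 0 1) (Pi.single 1 1) (Pi.single 2 1)
    simp only [HolMink.tanip_lcross] at this
    have e1 : Matrix.of ![B *ᵥ Pi.single 0 1, B *ᵥ Pi.single 1 1, B *ᵥ Pi.single 2 1] = Bᵀ := by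
      ext i j; fin_cases i <;> simp
    rw [e1, det_transpose] at this
    rw [this, det_fin_three]
    simp

section
variable {σ : Model} {N V : Fin 4 → Fin 4 → ℝ} (hD : IsVertexDual σ N V)
  {o : ∀ a b : Fin 4, tangent σ (V b) →ₗ[ℝ] tangent σ (V a)} (ho : IsTransportSystem σ V o)
include hD ho

theorem transport_ne {a b : Fin 4} (hab : a ≠ b) : 1 + σ.sgn * ambip σ (V b) (V a) ≠ 0 :=
  (IsEdgeTransport.eq_edgeMap (hD.mem b) (hD.mem a) (ho a b hab)).1

theorem transport_coe {a b : Fin 4} (hab : a ≠ b) (v : tangent σ (V b)) :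
    (o a b v : Fin 4 → ℝ) = transportMap σ V a b v :=
  (IsEdgeTransport.eq_edgeMap (hD.mem b) (hD.mem a) (ho a b hab)).2 v

theorem faceHolonomy_coe (i : Fin 4) (v : tangent σ (V 3)) :
    (faceHolonomy o i v : Fin 4 → ℝ) = ambientHolonomy σ V i v := by
  have h : ∀ {a b : Fin 4} (hab : a ≠ b) (v : tangent σ (V b)),
    (o a b v : Fin 4 → ℝ) = transportMap σ V a b v := transport_coe hD ho
  fin_cases i
  · change (o 3 2 (o 2 1 (o 1 3 v)) : Fin 4 → ℝ) = _
    rw [h (by decide), h (by decide), h (by decide)]; rfl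
  · change (o 3 0 (o 0 2 (o 2 3 v)) : Fin 4 → ℝ) = _
    rw [h (by decide), h (by decide), h (by decide)]; rfl
  · change (o 3 1 (o 1 0 (o 0 3 v)) : Fin 4 → ℝ) = _
    rw [h (by decide), h (by decide), h (by decide)]; rfl
  · change (o 3 1 (o 1 2 (o 2 0 (o 0 1 (o 1 3 v)))) : Fin 4 → ℝ) = _
    rw [h (by decide), h (by decide), h (by decide), h (by decide), h (by decide)]; rfl

omit ho in
theorem transportMap_fix {a b c : Fin 4} (hac : c ≠ a) (hbc : c ≠ b) :
    transportMap σ V a b (N c) = N c :=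
  edgeMap_fix (by rw [ambip_comm]; exact hD.orthogonal b c hbc)
    (by rw [ambip_comm]; exact hD.orthogonal a c hac)

theorem transportMap_transportMap {a b : Fin 4} (hab : a ≠ b) (v : Fin 4 → ℝ) :
    transportMap σ V a b (transportMap σ V b a v) = v := by
  unfold transportMap
  rw [edgeMap_comm σ (V a)]
  exact edgeMap_edgeMap (hD.mem b) (hD.mem a) (transport_ne hD ho hab) v

theorem ambip_transportMap {a b : Fin 4} (hab : a ≠ b) (v w : Fin 4 → ℝ) :
    ambip σ (transportMap σ V a b v) (transportMap σ V a b w) = ambip σ v w :=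
  ambip_edgeMap (hD.mem b) (hD.mem a) (transport_ne hD ho hab) v w

theorem det_transportMap {a b : Fin 4} (hab : a ≠ b) (x y z : Fin 4 → ℝ) :
    (Matrix.of ![V a, transportMap σ V a b x, transportMap σ V a b y, transportMap σ V a b z]).det =
      (Matrix.of ![V b, x, y, z]).det :=
  det_edgeMap (hD.mem b) (hD.mem a) (transport_ne hD ho hab) x y z

theorem transportMap_mem {a b c : Fin 4} (hab : a ≠ b) (hbc : c ≠ b) :
    ambip σ (transportMap σ V a b (N c)) (V a) = 0 :=
  edgeMap_mem_tangent (hD.mem b) (hD.mem a) (transport_ne hD ho hab)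
    (by rw [ambip_comm]; exact hD.orthogonal b c hbc)

theorem ambip_ambientHolonomy (i : Fin 4) (v w : Fin 4 → ℝ) :
    ambip σ (ambientHolonomy σ V i v) (ambientHolonomy σ V i w) = ambip σ v w := by
  have h : ∀ {a b : Fin 4} (hab : a ≠ b) (v w : Fin 4 → ℝ),
    ambip σ (transportMap σ V a b v) (transportMap σ V a b w) = ambip σ v w :=
    ambip_transportMap hD ho
  fin_cases i
  · exact (h (by decide) _ _).trans ((h (by decide) _ _).trans (h (by decide) _ _))
  · exact (h (by decide) _ _).trans ((h (by decide) _ _).trans (h (by decide) _ _))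
  · exact (h (by decide) _ _).trans ((h (by decide) _ _).trans (h (by decide) _ _))
  · exact (h (by decide) _ _).trans ((h (by decide) _ _).trans ((h (by decide) _ _).trans
      ((h (by decide) _ _).trans (h (by decide) _ _))))

theorem det_ambientHolonomy (i : Fin 4) (x y z : Fin 4 → ℝ) :
    (Matrix.of ![V 3, ambientHolonomy σ V i x, ambientHolonomy σ V i y,
      ambientHolonomy σ V i z]).det = (Matrix.of ![V 3, x, y, z]).det := by
  have h : ∀ {a b : Fin 4} (hab : a ≠ b) (x y z : Fin 4 → ℝ),
    (Matrix.of ![V a, transportMap σ V a b x, transportMap σ V a b y, transportMap σ V a b z]).det =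
      (Matrix.of ![V b, x, y, z]).det := det_transportMap hD ho
  fin_cases i
  · exact (h (by decide) _ _ _).trans ((h (by decide) _ _ _).trans (h (by decide) _ _ _))
  · exact (h (by decide) _ _ _).trans ((h (by decide) _ _ _).trans (h (by decide) _ _ _))
  · exact (h (by decide) _ _ _).trans ((h (by decide) _ _ _).trans (h (by decide) _ _ _))
  · exact (h (by decide) _ _ _).trans ((h (by decide) _ _ _).trans ((h (by decide) _ _ _).trans
      ((h (by decide) _ _ _).trans (h (by decide) _ _ _))))

/-- In the concatenated loops each passage along an edge is eventually adjacent to its reverse, and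
the word cancels completely. -/
theorem ambientHolonomy_closure (v : Fin 4 → ℝ) :
    ambientHolonomy σ V 3 (ambientHolonomy σ V 2 (ambientHolonomy σ V 1
      (ambientHolonomy σ V 0 v))) = v := by
  have h : ∀ {a b : Fin 4} (hab : a ≠ b) (v : Fin 4 → ℝ),
    transportMap σ V a b (transportMap σ V b a v) = v := transportMap_transportMap hD ho
  simp only [ambientHolonomy, cons_val]
  rw [h (a := 2) (b := 3) (by decide), h (a := 0) (b := 3) (by decide),
    h (a := 1) (b := 3) (by decide), h (a := 0) (b := 1) (by decide),
    h (a := 2) (b := 0) (by decide), h (a := 1) (b := 2) (by decide), h (by decide)]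

variable {E : Fin 3 → tangent σ (V 3)} (hE : IsFrame σ (V 3) E)
  {O : Fin 4 → Matrix (Fin 3) (Fin 3) ℝ} (hO : HolonomiesAre o E O)
include hO

theorem frameVec_mulVec (i : Fin 4) (x : Fin 3 → ℝ) :
    frameVec E (O i *ᵥ x) = ambientHolonomy σ V i (frameVec E x) := by
  rw [← coe_sum_smul E x, ← faceHolonomy_coe hD ho, map_sum, ← coe_sum_smul]
  congr 1
  simp only [map_smul, hO i, Finset.smul_sum, smul_smul]
  rw [Finset.sum_comm]
  refine Finset.sum_congr rfl fun a _ => ?_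
  rw [← Finset.sum_smul]
  congr 1
  simp only [mulVec, dotProduct, mul_comm]

variable {m : Fin 4 → Fin 3 → ℝ} (hm : TransportedNormalsAre N o E m)
include hE hm

omit hE hO in
theorem frameVec_three : frameVec E (m 3) = transportMap σ V 3 1 (N 3) := by
  obtain ⟨w, hw, hw'⟩ := hm.2
  rw [← hw, ← transport_coe hD ho (by decide), hw', coe_sum_smul]

/-- The first three loops run along edges of their own face, whose normal is fixed throughout. The
fourth is a loop of its face conjugated by the special edge, as is the transported normal `m 3`. -/
theorem isHolonomyData : IsHolonomyData O m := by
  have hN : ∀ i, i ≠ 3 → frameVec E (m i) = N i := fun i hi => (hm.1 i hi).symm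
  have h3 := frameVec_three hD ho hm
  have hf : ∀ {a b c : Fin 4} (hac : c ≠ a) (hbc : c ≠ b), transportMap σ V a b (N c) = N c :=
    transportMap_fix hD
  refine ⟨fun i => ?_, fun i => frameVec_injective hE ?_, ?_⟩
  · refine IsSO.of_tanip (fun x y => ?_) (fun x y z => ?_)
    · rw [← ambip_frameVec hE, ← ambip_frameVec hE, frameVec_mulVec hD ho hO,
        frameVec_mulVec hD ho hO, ambip_ambientHolonomy hD ho]
    · apply mul_right_cancel₀ hE.oriented.ne'
      rw [← det_frameVec, ← det_frameVec, frameVec_mulVec hD ho hO,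
        frameVec_mulVec hD ho hO, frameVec_mulVec hD ho hO, det_ambientHolonomy hD ho]
  · rw [frameVec_mulVec hD ho hO]
    fin_cases i
    · change ambientHolonomy σ V 0 (frameVec E (m 0)) = frameVec E (m 0)
      rw [hN 0 (by decide)]
      simp only [ambientHolonomy, cons_val]
      rw [hf (by decide) (by decide), hf (by decide) (by decide), hf (by decide) (by decide)]
    · change ambientHolonomy σ V 1 (frameVec E (m 1)) = frameVec E (m 1)
      rw [hN 1 (by decide)]
      simp only [ambientHolonomy, cons_val]
      rw [hf (by decide) (by decide), hf (by decide) (by decide), hf (by decide) (by decide)]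
    · change ambientHolonomy σ V 2 (frameVec E (m 2)) = frameVec E (m 2)
      rw [hN 2 (by decide)]
      simp only [ambientHolonomy, cons_val]
      rw [hf (by decide) (by decide), hf (by decide) (by decide), hf (by decide) (by decide)]
    · change ambientHolonomy σ V 3 (frameVec E (m 3)) = frameVec E (m 3)
      rw [h3]
      simp only [ambientHolonomy, cons_val]
      rw [transportMap_transportMap hD ho (by decide), hf (by decide) (by decide),
        hf (by decide) (by decide), hf (by decide) (by decide)]
  · refine eq_of_mulVec_eq fun z => frameVec_injective hE ?_
    rw [one_mulVec, ← mulVec_mulVec, ← mulVec_mulVec, ← mulVec_mulVec, frameVec_mulVec hD ho hO,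
      frameVec_mulVec hD ho hO, frameVec_mulVec hD ho hO, frameVec_mulVec hD ho hO,
      ambientHolonomy_closure hD ho]

-- This explains the exceptional Gram entry: transport from the vertex with index 2 fixes `N 1`,
-- whereas transport along the special edge need not.
omit hE in
theorem frameVec_mulVec_three : frameVec E (O 0 *ᵥ m 3) = transportMap σ V 3 2 (N 3) := by
  rw [frameVec_mulVec hD ho hO, frameVec_three hD ho hm]
  simp only [ambientHolonomy, cons_val]
  rw [transportMap_transportMap hD ho (by decide), transportMap_fix hD (by decide) (by decide)]

theorem frameVec_inv_mulVec_three :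
    frameVec E ((O 2)⁻¹ *ᵥ m 3) = transportMap σ V 3 0 (N 3) := by
  obtain ⟨r, hr⟩ := exists_frameVec hE (transportMap_mem hD ho (a := 3) (b := 0) (c := 3)
    (by decide) (by decide))
  have h : O 2 *ᵥ r = m 3 := by
    apply frameVec_injective hE
    rw [frameVec_mulVec hD ho hO, ← hr, frameVec_three hD ho hm]
    simp only [ambientHolonomy, cons_val]
    rw [transportMap_transportMap hD ho (by decide), transportMap_fix hD (by decide) (by decide)]
  rw [hr, ← h, ((isHolonomyData hD ho hE hO hm).isSO 2).inv_mulVec]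

/-- The Gram matrix of the holonomy data is that of the outward normals. -/
theorem faceGram_eq_ambip (i j : Fin 4) : faceGram O m i j = ambip σ (N i) (N j) := by
  have hN : ∀ i, i ≠ 3 → frameVec E (m i) = N i := fun i hi => (hm.1 i hi).symm
  have h3 := frameVec_three hD ho hm
  wlog hij : i ≤ j generalizing i j
  · rw [faceGram_symm, this j i (le_of_not_ge hij), ambip_comm]
  by_cases hj : j = 3
  · subst hj
    by_cases hi3 : i = 3
    · subst hi3
      rw [faceGram_apply O m (by decide), ← ambip_frameVec hE, h3, ambip_transportMap hD ho
        (by decide)]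
    by_cases hi : i = 1
    · subst hi
      rw [faceGram_one_three, ← ambip_frameVec hE, frameVec_mulVec_three hD ho hO hm,
        hN 1 (by decide), ← ambip_transportMap hD ho (a := 3) (b := 2) (by decide) (N 1) (N 3),
        transportMap_fix hD (c := 1) (by decide) (by decide)]
    · rw [faceGram_apply O m (by simp [hi, hi3]), ← ambip_frameVec hE, h3, hN i hi3,
        ← ambip_transportMap hD ho (a := 3) (b := 1) (by decide) (N i) (N 3),
        transportMap_fix hD hi3 hi]
  · have hi : i ≠ 3 := by
      rintro rfl
      exact hj (le_antisymm (Fin.le_last j) hij)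
    rw [faceGram_apply O m (by simp [hi, hj]), ← ambip_frameVec hE, hN i hi, hN j hj]

/-- The four triple products of the holonomy data have one common sign. -/
theorem exists_chi_pos : ∃ κ : ℝ, ∀ i, 0 < κ * chi O m i := by
  have hN : ∀ i, i ≠ 3 → frameVec E (m i) = N i := fun i hi => (hm.1 i hi).symm
  have hf : ∀ {a b c : Fin 4} (hac : c ≠ a) (hbc : c ≠ b), transportMap σ V a b (N c) = N c :=
    transportMap_fix hD
  set δ := (Matrix.of ![V 3, (E 0 : Fin 4 → ℝ), (E 1 : Fin 4 → ℝ), (E 2 : Fin 4 → ℝ)]).det with hδ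
  have hδ0 : 0 < δ := hE.oriented
  have hdet := hD.det_ne_zero
  have hNrow : Matrix.of N = Matrix.of ![N 0, N 1, N 2, N 3] := by
    ext i j; fin_cases i <;> rfl
  -- Transport preserves oriented volume, so each triple product can be evaluated at the vertex from
  -- which its copy of the fourth normal came.
  have c0 : chi O m 0 * δ = (Matrix.of ![V 0, N 2, N 1, N 3]).det := by
    rw [chi_zero, hδ, ← det_frameVec, frameVec_inv_mulVec_three hD ho hE hO hm, hN 1 (by decide),
      hN 2 (by decide), ← det_transportMap hD ho (a := 3) (b := 0) (by decide),
      hf (c := 2) (by decide) (by decide), hf (c := 1) (by decide) (by decide)]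
  have c1 : chi O m 1 * δ = (Matrix.of ![V 1, N 0, N 2, N 3]).det := by
    rw [chi_one, hδ, ← det_frameVec, frameVec_three hD ho hm, hN 0 (by decide),
      hN 2 (by decide), ← det_transportMap hD ho (a := 3) (b := 1) (by decide),
      hf (c := 0) (by decide) (by decide), hf (c := 2) (by decide) (by decide)]
  have c2 : chi O m 2 * δ = (Matrix.of ![V 2, N 1, N 0, N 3]).det := by
    rw [chi_two, hδ, ← det_frameVec, frameVec_mulVec_three hD ho hO hm, hN 0 (by decide),
      hN 1 (by decide), ← det_transportMap hD ho (a := 3) (b := 2) (by decide),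
      hf (c := 1) (by decide) (by decide), hf (c := 0) (by decide) (by decide)]
  have c3 : chi O m 3 * δ = (Matrix.of ![V 3, N 0, N 1, N 2]).det := by
    rw [chi_three, hδ, ← det_frameVec, hN 0 (by decide), hN 1 (by decide), hN 2 (by decide)]
  -- Only the `N i` term of `V i` survives in the determinant, and the order of factors in each
  -- `χ_i` makes the remaining permutation odd.
  have key : ∀ i, ∃ a : ℝ, σ.sgn * a < 0 ∧ chi O m i * δ = -(a * (Matrix.of N).det) := by
    intro i
    obtain ⟨a, ha, hneg⟩ := hD.exists_eq_sum i
    refine ⟨a i, hneg, ?_⟩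
    rw [hNrow]
    fin_cases i
    · refine c0.trans ?_
      change _ = -(a 0 * _)
      change V 0 = _ at ha
      rw [ha]
      rw [det_four, det_four]
      simp only [Fin.sum_univ_four, Pi.add_apply, Pi.smul_apply, smul_eq_mul]
      ring
    · refine c1.trans ?_
      change _ = -(a 1 * _)
      change V 1 = _ at ha
      rw [ha]
      rw [det_four, det_four]
      simp only [Fin.sum_univ_four, Pi.add_apply, Pi.smul_apply, smul_eq_mul]
      ring
    · refine c2.trans ?_
      change _ = -(a 2 * _)
      change V 2 = _ at ha
      rw [ha]
      rw [det_four, det_four]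
      simp only [Fin.sum_univ_four, Pi.add_apply, Pi.smul_apply, smul_eq_mul]
      ring
    · refine c3.trans ?_
      change _ = -(a 3 * _)
      change V 3 = _ at ha
      rw [ha]
      rw [det_four, det_four]
      simp only [Fin.sum_univ_four, Pi.add_apply, Pi.smul_apply, smul_eq_mul]
      ring
  refine ⟨σ.sgn * (Matrix.of N).det * δ, fun i => ?_⟩
  obtain ⟨a, ha, hχ⟩ := key i
  have : σ.sgn * (Matrix.of N).det * δ * chi O m i = -(σ.sgn * a) * (Matrix.of N).det ^ 2 := by
    linear_combination (σ.sgn * (Matrix.of N).det) * hχ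
  rw [this]
  exact mul_pos (neg_pos.2 ha) (by positivity)

end

theorem ambip_sum_left (σ : Model) (c : Fin 4 → ℝ) (X : Fin 4 → Fin 4 → ℝ) (Z : Fin 4 → ℝ) :
    ambip σ (∑ j, c j • X j) Z = ∑ j, c j * ambip σ (X j) Z := by
  simp only [Fin.sum_univ_four, ambip_add_left, ambip_smul_left]

/-! ### Strict convexity in terms of dual vertices -/

/-- A vertex on its opposite face would be orthogonal to four independent normals, hence zero. -/
theorem IsStrictlyConvexTetrahedron.isVertexDual {σ : Model} {N V : Fin 4 → Fin 4 → ℝ}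
    (h : IsStrictlyConvexTetrahedron σ N V) : IsVertexDual σ N V := by
  have hmem : ∀ i, V i ∈ space σ := by
    intro i
    obtain ⟨j, hj⟩ : ∃ j, j ≠ i := exists_ne i
    exact (h.vertex_mem i j hj).1
  refine ⟨hmem, fun i j hj => (h.vertex_mem i j hj).2, fun i => ?_⟩
  have hle : ambip σ (V i) (N i) ≤ 0 := (mem_of_mem_nhdsWithin (hmem i) (h.vertex_interior i)).2
  refine lt_of_le_of_ne hle fun h0 => ?_
  have hV : V i = 0 := by
    refine eq_zero_of_orthogonal (σ := σ) h.linearIndependent fun j => ?_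
    by_cases hj : j = i
    · rw [hj, h0]
    · exact (h.vertex_mem i j hj).2
  have := mem_space.1 (hmem i)
  rw [hV, ambip_zero_left] at this
  exact σ.sgn_ne_zero this.symm

namespace IsVertexDual
variable {σ : Model} {N V : Fin 4 → Fin 4 → ℝ} (hD : IsVertexDual σ N V)
include hD

theorem ambip_sum_vertices (c : Fin 4 → ℝ) (j : Fin 4) :
    ambip σ (∑ i, c i • V i) (N j) = c j * ambip σ (V j) (N j) := by
  rw [ambip_sum_left, Finset.sum_eq_single j]
  · intro i _ hi; rw [hD.orthogonal i j hi.symm, mul_zero]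
  · simp

theorem eq_sum_vertices (X : Fin 4 → ℝ) :
    X = ∑ i, (ambip σ X (N i) / ambip σ (V i) (N i)) • V i := by
  rw [← sub_eq_zero]
  refine eq_zero_of_orthogonal (σ := σ) hD.linearIndependent fun j => ?_
  rw [ambip_sub_left, hD.ambip_sum_vertices, div_mul_cancel₀ _ (hD.neg j).ne, sub_self]

/-- In the basis `V` a point has the coordinates `⟨X, N i⟩ / ⟨V i, N i⟩` with negative denominators,
so half-spaces and faces become sign conditions on the coefficients of the cone. -/
theorem isStrictlyConvexTetrahedron : IsStrictlyConvexTetrahedron σ N V where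
  linearIndependent := hD.linearIndependent
  vertex_mem i j hj := ⟨hD.mem i, hD.orthogonal i j hj⟩
  region_eq := by
    ext X
    constructor
    · intro hX
      have hX' := fun i => Set.mem_iInter.1 hX i
      refine ⟨(hX' 0).1, _, fun i => ?_, fun i hi => absurd (Set.mem_univ i) hi,
        hD.eq_sum_vertices X⟩
      exact div_nonneg_of_nonpos (hX' i).2 (hD.neg i).le
    · rintro ⟨hX, c, hc, -, rfl⟩
      refine Set.mem_iInter.2 fun i => ⟨hX, ?_⟩
      rw [hD.ambip_sum_vertices]
      exact mul_nonpos_of_nonneg_of_nonpos (hc i) (hD.neg i).le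
  vertex_interior i := by
    rw [mem_nhdsWithin]
    refine ⟨{X | ambip σ X (N i) < 0}, ?_, hD.neg i, fun X hX => ⟨hX.2, le_of_lt hX.1⟩⟩
    refine isOpen_lt ?_ continuous_const
    simp only [ambip_eq]
    fun_prop
  face_eq i := by
    ext X
    constructor
    · rintro ⟨hX, hX0⟩
      have hX' := fun i => Set.mem_iInter.1 hX i
      refine ⟨hX0.1, _, fun j => div_nonneg_of_nonpos (hX' j).2 (hD.neg j).le, fun j hj => ?_,
        hD.eq_sum_vertices X⟩
      have hji : j = i := by simpa using hj
      rw [hji, hX0.2, zero_div]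
    · rintro ⟨hX, c, hc, hi, rfl⟩
      refine ⟨Set.mem_iInter.2 fun j => ⟨hX, ?_⟩, hX, ?_⟩
      · rw [hD.ambip_sum_vertices]
        exact mul_nonpos_of_nonneg_of_nonpos (hc j) (hD.neg j).le
      · rw [hD.ambip_sum_vertices, hi i (by simp), zero_mul]

theorem smul {c : Fin 4 → ℝ} (hc : ∀ i, 0 < c i) : IsVertexDual σ (fun i => c i • N i) V where
  mem := hD.mem
  orthogonal i j hj := by rw [ambip_smul_right, hD.orthogonal i j hj, mul_zero]
  neg i := by rw [ambip_smul_right]; exact mul_neg_of_pos_of_neg (hc i) (hD.neg i)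

end IsVertexDual

/-! ### Congruence of tetrahedra with the same Gram matrix -/

theorem gram_eq (σ : Model) (N : Fin 4 → Fin 4 → ℝ) (i j : Fin 4) :
    (Matrix.of N * σ.eta * (Matrix.of N)ᵀ) i j = ambip σ (N i) (N j) := by
  simp only [ambip, Matrix.mul_apply, dotProduct, mulVec, transpose_apply, of_apply,
    Fin.sum_univ_four]
  ring

theorem det_eta (σ : Model) : σ.eta.det = -σ.sgn := by
  cases σ <;> simp [Model.eta, Model.sgn, det_diagonal, Fin.prod_univ_four]

/-- The Gram determinant equals `-σ (det N)²`, so its sign distinguishes the two models. -/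
theorem model_eq_of_gram_eq {σ σ' : Model} {N N' : Fin 4 → Fin 4 → ℝ}
    (hN : (Matrix.of N).det ≠ 0)
    (hG : ∀ i j, ambip σ' (N' i) (N' j) = ambip σ (N i) (N j)) : σ' = σ := by
  have h : Matrix.of N' * σ'.eta * (Matrix.of N')ᵀ = Matrix.of N * σ.eta * (Matrix.of N)ᵀ := by
    ext i j; rw [gram_eq, gram_eq, hG]
  have hdet := congrArg Matrix.det h
  simp only [det_mul, det_transpose, det_eta] at hdet
  have hpos : 0 < (Matrix.of N).det ^ 2 := by positivity
  cases σ <;> cases σ' <;> simp [Model.sgn] at hdet ⊢ <;> nlinarith [sq_nonneg (Matrix.of N').det]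

theorem ambip_mulVec {σ : Model} {L : Matrix (Fin 4) (Fin 4) ℝ} (hL : IsAmbientIsometry σ L)
    (X Y : Fin 4 → ℝ) : ambip σ (L *ᵥ X) (L *ᵥ Y) = ambip σ X Y := by
  unfold ambip
  rw [← vecMul_transpose, ← dotProduct_mulVec, mulVec_mulVec, mulVec_mulVec, hL]

theorem exists_isometry_of_gram_eq {σ : Model} {N V N' V' : Fin 4 → Fin 4 → ℝ}
    (hD : IsVertexDual σ N V) (hD' : IsVertexDual σ N' V')
    (hG : ∀ i j, ambip σ (N' i) (N' j) = ambip σ (N i) (N j)) :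
    ∃ L, IsAmbientIsometry σ L ∧ (∀ i, N' i = L *ᵥ N i) ∧ ∀ i, V' i = L *ᵥ V i := by
  have h : Matrix.of N' * σ.eta * (Matrix.of N')ᵀ = Matrix.of N * σ.eta * (Matrix.of N)ᵀ := by
    ext i j; rw [gram_eq, gram_eq, hG]
  have hu : IsUnit (Matrix.of N).det := hD.det_ne_zero.isUnit
  have hut : IsUnit (Matrix.of N)ᵀ.det := by rwa [det_transpose]
  set L := (Matrix.of N')ᵀ * ((Matrix.of N)ᵀ)⁻¹ with hLd
  have hLN : L * (Matrix.of N)ᵀ = (Matrix.of N')ᵀ := by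
    rw [hLd, Matrix.mul_assoc, nonsing_inv_mul _ hut, Matrix.mul_one]
  have hN' : ∀ i, N' i = L *ᵥ N i := by
    intro i
    ext j
    have := congrFun (congrFun hLN j) i
    rw [Matrix.mul_apply] at this
    exact this.symm
  have hL : IsAmbientIsometry σ L := by
    have e : Matrix.of N * (Lᵀ * σ.eta * L) * (Matrix.of N)ᵀ =
        Matrix.of N * σ.eta * (Matrix.of N)ᵀ := by
      rw [← h, ← hLN]
      have : Matrix.of N' = Matrix.of N * Lᵀ := by
        rw [← transpose_transpose (Matrix.of N'), ← hLN, transpose_mul, transpose_transpose]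
      rw [this]
      simp only [Matrix.mul_assoc]
    have e1 := ((Matrix.isUnit_iff_isUnit_det _).2 hut).mul_right_cancel e
    exact ((Matrix.isUnit_iff_isUnit_det _).2 hu).mul_left_cancel e1
  refine ⟨L, hL, hN', fun i => ?_⟩
  have hLV : ∀ j, ambip σ (L *ᵥ V i) (N' j) = ambip σ (V i) (N j) := fun j => by
    rw [hN' j, ambip_mulVec hL]
  -- `L *ᵥ V i` is orthogonal to the same three normals as `V' i`; the multiple is positive as both
  -- points lie inside, and equal norms make it `1`.
  set k := ambip σ (V' i) (N' i) / ambip σ (V i) (N i) with hk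
  have hk0 : 0 < k := div_pos_of_neg_of_neg (hD'.neg i) (hD.neg i)
  have hV : V' i = k • (L *ᵥ V i) := by
    rw [← sub_eq_zero]
    refine eq_zero_of_orthogonal (σ := σ) hD'.linearIndependent fun j => ?_
    rw [ambip_sub_left, ambip_smul_left, hLV]
    by_cases hj : j = i
    · rw [hj, hk, div_mul_cancel₀ _ (hD.neg i).ne, sub_self]
    · rw [hD'.orthogonal i j hj, hD.orthogonal i j hj, mul_zero, sub_self]
  have hs := mem_space.1 (hD'.mem i)
  rw [hV, ambip_smul_left, ambip_smul_right, ambip_mulVec hL, mem_space.1 (hD.mem i), ← mul_assoc]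
    at hs
  have hk1 : k * k = 1 := mul_right_cancel₀ σ.sgn_ne_zero (by rw [hs, one_mul])
  have : k = 1 := by nlinarith
  rw [hV, this, one_smul]

theorem IsAmbientIsometry.exists_mulVec_eq {σ : Model} {L : Matrix (Fin 4) (Fin 4) ℝ}
    (hL : IsAmbientIsometry σ L) (X : Fin 4 → ℝ) : ∃ Y, L *ᵥ Y = X := by
  have hd := congrArg Matrix.det hL
  simp only [det_mul, det_transpose, det_eta] at hd
  have hu : L.det ≠ 0 := by
    intro h0
    rw [h0] at hd
    simp [σ.sgn_ne_zero] at hd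
  exact ⟨L⁻¹ *ᵥ X, by rw [mulVec_mulVec, mul_nonsing_inv _ hu.isUnit, one_mulVec]⟩

/-- Tetrahedra whose suitably scaled normals have the same Gram matrix are congruent. -/
theorem congruentTetrahedra_of_gram_eq {σ : Model} {N V N' V' : Fin 4 → Fin 4 → ℝ}
    (hD : IsVertexDual σ N V) (hD' : IsVertexDual σ N' V') {c : Fin 4 → ℝ} (hc : ∀ i, 0 < c i)
    (hG : ∀ i j, ambip σ (c i • N' i) (c j • N' j) = ambip σ (N i) (N j)) :
    CongruentTetrahedra σ N V N' V' := by
  obtain ⟨L, hL, hN, hV⟩ := exists_isometry_of_gram_eq hD (hD'.smul hc) hG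
  have hN' : ∀ i, N' i = (c i)⁻¹ • (L *ᵥ N i) := fun i => by
    rw [← hN i, smul_smul, inv_mul_cancel₀ (hc i).ne', one_smul]
  have hmem : ∀ X, L *ᵥ X ∈ region σ N' ↔ X ∈ region σ N := by
    intro X
    simp only [region, Set.mem_iInter, halfSpace, space, Set.mem_ofPred_eq, ambip_mulVec hL, hN',
      ambip_smul_right]
    refine forall_congr' fun i => and_congr_right fun _ => ?_
    have := inv_pos.2 (hc i)
    exact ⟨fun h => nonpos_of_mul_nonpos_right h this,
      fun h => mul_nonpos_of_nonneg_of_nonpos this.le h⟩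
  refine ⟨L, hL, hV, fun i => ⟨_, inv_pos.2 (hc i), hN' i⟩, ?_⟩
  ext X
  constructor
  · intro hX
    obtain ⟨Y, rfl⟩ := hL.exists_mulVec_eq X
    exact ⟨Y, (hmem Y).1 hX, rfl⟩
  · rintro ⟨Y, hY, rfl⟩
    exact (hmem Y).2 hY

/-! ### Existence -/

theorem exists_frame (σ : Model) : ∃ (p : Fin 4 → ℝ) (E : Fin 3 → tangent σ p),
    p ∈ space σ ∧ IsFrame σ p E := by
  cases σ
  -- The minus sign makes the frame positively oriented.
  · refine ⟨![0, -1, 0, 0], ![⟨![1, 0, 0, 0], ?_⟩, ⟨![0, 0, 1, 0], ?_⟩, ⟨![0, 0, 0, 1], ?_⟩], ?_,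
      fun a b => ?_, ?_, ?_⟩
    · simp [mem_tangent, ambip_eq]
    · simp [mem_tangent, ambip_eq]
    · simp [mem_tangent, ambip_eq]
    · simp [mem_space, ambip_eq]
    · fin_cases a <;> fin_cases b <;> simp [ambip_eq, etaT]
    · simp [det_four]
    · simp [IsFuture]
  · refine ⟨![1, 0, 0, 0], ![⟨![0, 1, 0, 0], ?_⟩, ⟨![0, 0, 1, 0], ?_⟩, ⟨![0, 0, 0, 1], ?_⟩], ?_,
      fun a b => ?_, ?_, ?_⟩
    · simp [mem_tangent, ambip_eq]
    · simp [mem_tangent, ambip_eq]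
    · simp [mem_tangent, ambip_eq]
    · simp [mem_space, ambip_eq, Model.sgn]
    · fin_cases a <;> fin_cases b <;> simp [ambip_eq, etaT, Model.sgn]
    · simp [det_four]
    · simp [IsFuture]

theorem exists_tanip_eq {a b c : Fin 3 → ℝ} (h : tanip (lcross a b) c ≠ 0) (x y z : ℝ) :
    ∃ v, tanip v a = x ∧ tanip v b = y ∧ tanip v c = z := by
  refine ⟨(tanip (lcross a b) c)⁻¹ • (x • lcross b c + y • lcross c a + z • lcross a b), ?_⟩
  have e : ∀ w, tanip ((tanip (lcross a b) c)⁻¹ • (x • lcross b c + y • lcross c a +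
      z • lcross a b)) w = (tanip (lcross a b) c)⁻¹ * (x * tanip (lcross b c) w +
        y * tanip (lcross c a) w + z * tanip (lcross a b) w) := by
    intro w
    simp only [tanip_eq, Pi.smul_apply, Pi.add_apply, smul_eq_mul]; ring
  have h0 : ∀ u w, tanip (lcross u w) u = 0 ∧ tanip (lcross u w) w = 0 := by
    intro u w
    constructor <;>
      simp only [tanip_eq, lcross_apply_zero, lcross_apply_one, lcross_apply_two] <;> ring
  refine ⟨?_, ?_, ?_⟩
  · rw [e, (h0 c a).2, (h0 a b).1, tanip_lcross_cycle a b c]; field_simp; ring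
  · rw [e, (h0 b c).1, (h0 a b).2, ← tanip_lcross_cycle c a b]; field_simp; ring
  · rw [e, (h0 b c).2, (h0 c a).1]; field_simp; ring

/-- A Schur complement: `y` is the tangential part of the fourth normal to be built, and `faceGram O
m 3 3 - tanip y y` is the squared norm left for its component along the base point. Its sign is
therefore that of `-det G`. -/
theorem det_faceGram {O : Fin 4 → Matrix (Fin 3) (Fin 3) ℝ} {m : Fin 4 → Fin 3 → ℝ}
    {y : Fin 3 → ℝ} (hy : ∀ j, j ≠ 3 → tanip y (m j) = faceGram O m 3 j) :
    (faceGram O m).det = -chi O m 3 ^ 2 * (faceGram O m 3 3 - tanip y y) := by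
  set A : Matrix (Fin 4) (Fin 4) ℝ := Matrix.of ![![0, m 0 0, m 0 1, m 0 2],
    ![0, m 1 0, m 1 1, m 1 2], ![0, m 2 0, m 2 1, m 2 2], ![1, y 0, y 1, y 2]] with hA
  have hG : faceGram O m =
      A * Matrix.diagonal ![faceGram O m 3 3 - tanip y y, -1, 1, 1] * Aᵀ := by
    have h0 := hy 0 (by decide)
    have h1 := hy 1 (by decide)
    have h2 := hy 2 (by decide)
    have e : ∀ i j, (A * Matrix.diagonal ![faceGram O m 3 3 - tanip y y, -1, 1, 1] * Aᵀ) i j =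
        A i 0 * A j 0 * (faceGram O m 3 3 - tanip y y) - A i 1 * A j 1 + A i 2 * A j 2 +
          A i 3 * A j 3 := by
      intro i j
      rw [Matrix.mul_apply]
      simp [Matrix.mul_diagonal, Fin.sum_univ_four]
      ring
    ext i j
    rw [e]
    wlog hij : i ≤ j generalizing i j
    · rw [faceGram_symm, this j i (le_of_not_ge hij)]; ring
    by_cases hj : j = 3
    · subst hj
      fin_cases i
      · rw [faceGram_symm]
        refine h0.symm.trans ?_
        simp [hA, tanip_eq]; ring
      · rw [faceGram_symm]
        refine h1.symm.trans ?_
        simp [hA, tanip_eq]; ring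
      · rw [faceGram_symm]
        refine h2.symm.trans ?_
        simp [hA, tanip_eq]; ring
      · simp [hA, tanip_eq]; ring
    · have hi : i ≠ 3 := by
        rintro rfl
        exact hj (le_antisymm (Fin.le_last j) hij)
      rw [faceGram_apply O m (by simp [hi, hj])]
      fin_cases i <;> fin_cases j <;> first | exact absurd rfl hi | exact absurd rfl hj | skip
      all_goals simp [hA, tanip_eq]; try ring
  rw [hG, det_mul, det_mul, det_transpose, det_diagonal, Fin.prod_univ_four]
  have hdA : A.det = -chi O m 3 := by
    rw [chi_three, tanip_lcross, hA, det_four, det_fin_three]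
    simp
    ring
  rw [hdA]
  simp [← hG]
  ring

theorem exists_transportedNormals {σ : Model} {N V : Fin 4 → Fin 4 → ℝ} (hD : IsVertexDual σ N V)
    {o : ∀ a b : Fin 4, tangent σ (V b) →ₗ[ℝ] tangent σ (V a)} (ho : IsTransportSystem σ V o)
    {E : Fin 3 → tangent σ (V 3)} (hE : IsFrame σ (V 3) E) : ∃ m, TransportedNormalsAre N o E m := by
  have hx : ∀ i, ∃ x : Fin 3 → ℝ, (i ≠ 3 → N i = frameVec E x) ∧
      (i = 3 → transportMap σ V 3 1 (N 3) = frameVec E x) := by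
    intro i
    by_cases hi : i = 3
    · obtain ⟨y, hy⟩ := exists_frameVec hE (transportMap_mem hD ho (a := 3) (b := 1) (c := 3)
        (by decide) (by decide))
      exact ⟨y, fun h => absurd hi h, fun _ => hy⟩
    · obtain ⟨y, hy⟩ := exists_frameVec hE (v := N i)
        (by rw [ambip_comm]; exact hD.orthogonal 3 i hi)
      exact ⟨y, fun _ => hy, fun h => absurd h hi⟩
  choose m hm hm3 using hx
  refine ⟨m, hm, ⟨N 3, ?_⟩, rfl, ?_⟩
  · rw [mem_tangent, ambip_comm]
    exact hD.orthogonal 1 3 (by decide)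
  · apply Subtype.ext
    rw [coe_sum_smul, transport_coe hD ho (by decide), hm3 3 rfl]

section
variable {O : Fin 4 → Matrix (Fin 3) (Fin 3) ℝ} {m : Fin 4 → Fin 3 → ℝ}
  (h : IsHolonomyData O m) (hχ : ∀ i, 0 < chi O m i) {σ : Model}
include h hχ

/-- By the cofactor formula the diagonal entry is `-χ_i² / det G`. It is the squared norm of the
dual vector, which can thus be scaled into `M_σ`. -/
theorem faceGram_inv_sign (hσ : σ.sgn * (faceGram O m).det < 0) (i : Fin 4) :
    0 < σ.sgn * (faceGram O m)⁻¹ i i := by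
  have hdet : (faceGram O m).det ≠ 0 := right_ne_zero_of_mul hσ.ne
  rw [Matrix.inv_def, Ring.inverse_eq_inv', Matrix.smul_apply, smul_eq_mul,
    adjugate_fin_succ_eq_det_submatrix, ← two_mul, pow_mul, h.det_submatrix]
  have e : σ.sgn * ((faceGram O m).det⁻¹ * ((((-1) ^ 2) ^ (i : ℕ)) * -chi O m i ^ 2)) =
      -(σ.sgn * (faceGram O m).det) * (chi O m i / (faceGram O m).det) ^ 2 := by
    rw [neg_one_sq, one_pow]
    field_simp
  rw [e]
  exact mul_pos (neg_pos.2 hσ) (sq_pos_of_ne_zero (div_ne_zero (hχ i).ne' hdet))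

omit h in
/-- Linearly independent normals with the Gram matrix of the holonomy data. -/
theorem exists_normals (hσ : σ.sgn * (faceGram O m).det < 0) {p : Fin 4 → ℝ}
    {E : Fin 3 → tangent σ p} (hp : p ∈ space σ) (hE : IsFrame σ p E) :
    ∃ N : Fin 4 → Fin 4 → ℝ, (∀ i, i ≠ 3 → N i = frameVec E (m i)) ∧ ambip σ p (N 3) < 0 ∧
      ∀ i j, ambip σ (N i) (N j) = faceGram O m i j := by
  obtain ⟨y, hy0, hy1, hy2⟩ := exists_tanip_eq (hχ 3).ne' (faceGram O m 3 0) (faceGram O m 3 1)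
    (faceGram O m 3 2)
  have hy : ∀ j, j ≠ 3 → tanip y (m j) = faceGram O m 3 j := by
    intro j hj
    fin_cases j
    · exact hy0
    · exact hy1
    · exact hy2
    · exact absurd rfl hj
  have hs := σ.sgn_mul_self
  have hd : 0 < σ.sgn * (faceGram O m 3 3 - tanip y y) := by
    rw [det_faceGram hy] at hσ
    have := pow_pos (hχ 3) 2
    by_contra! hle
    nlinarith [mul_nonneg this.le (neg_nonneg.2 hle)]
  obtain ⟨r, hr0, hr⟩ : ∃ r, 0 < r ∧ r * r = σ.sgn * (faceGram O m 3 3 - tanip y y) :=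
    ⟨_, Real.sqrt_pos.2 hd, Real.mul_self_sqrt hd.le⟩
  have hpf : ∀ x, ambip σ p (frameVec E x) = 0 := fun x => by rw [ambip_comm, frameVec_mem]
  -- The choice of `r` gives the prescribed norm; the factor `-σ` makes the product with `p` equal
  -- to `-r`.
  refine ⟨fun i => if i = 3 then (-(σ.sgn * r)) • p + frameVec E y else frameVec E (m i),
    fun i hi => if_neg hi, ?_, fun i j => ?_⟩
  · simp only [if_true]
    rw [ambip_add_right, ambip_smul_right, hpf, mem_space.1 hp]
    nlinarith
  · have h33 : ambip σ ((-(σ.sgn * r)) • p + frameVec E y) ((-(σ.sgn * r)) • p + frameVec E y) =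
        faceGram O m 3 3 := by
      simp only [ambip_add_right, ambip_smul_right, ambip_add_left, ambip_smul_left, hpf,
        frameVec_mem, mem_space.1 hp, ambip_frameVec hE]
      linear_combination (σ.sgn * σ.sgn * σ.sgn) * hr +
        (faceGram O m 3 3 - tanip y y) * (σ.sgn * σ.sgn + 1) * hs
    have h3 : ∀ j, j ≠ 3 → ambip σ ((-(σ.sgn * r)) • p + frameVec E y) (frameVec E (m j)) =
        faceGram O m 3 j := fun j hj => by
      rw [ambip_add_left, ambip_smul_left, hpf, ambip_frameVec hE, hy j hj, mul_zero, zero_add]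
    by_cases hi : i = 3 <;> by_cases hj : j = 3
    · simp only [hi, hj, if_true, h33]
    · simp only [hi, hj, if_true, if_false, h3 j hj]
    · simp only [hi, hj, if_true, if_false]
      rw [ambip_comm, h3 i hi, faceGram_symm]
    · simp only [hi, hj, if_false]
      rw [ambip_frameVec hE, faceGram_apply O m (by simp [hi, hj])]

/-- Vertices dual to normals with the Gram matrix of the holonomy data. -/
theorem exists_vertex (hσ : σ.sgn * (faceGram O m).det < 0) {N : Fin 4 → Fin 4 → ℝ}
    (hN : ∀ i j, ambip σ (N i) (N j) = faceGram O m i j) (i : Fin 4) :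
    ∃ v ∈ space σ, (∀ j, j ≠ i → ambip σ v (N j) = 0) ∧ ambip σ v (N i) < 0 := by
  have hdet : (faceGram O m).det ≠ 0 := right_ne_zero_of_mul hσ.ne
  have hpos := faceGram_inv_sign h hχ hσ i
  have hs := σ.sgn_mul_self
  obtain ⟨r, hr0, hr⟩ : ∃ r, 0 < r ∧ r * r = σ.sgn * (faceGram O m)⁻¹ i i :=
    ⟨_, Real.sqrt_pos.2 hpos, Real.mul_self_sqrt hpos.le⟩
  -- The dual basis vector, of squared norm `σ r²`; the factor `-r⁻¹` normalises it and puts it on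
  -- the inner side of the face.
  set u := ∑ k, (faceGram O m)⁻¹ i k • N k with hu
  have hun : ∀ j, ambip σ u (N j) = (1 : Matrix (Fin 4) (Fin 4) ℝ) i j := by
    intro j
    rw [hu, ambip_sum_left, ← nonsing_inv_mul _ hdet.isUnit, Matrix.mul_apply]
    simp only [hN]
  have huu : ambip σ u u = (faceGram O m)⁻¹ i i := by
    conv_lhs => rw [hu]
    rw [ambip_sum_left, Finset.sum_eq_single i]
    · rw [ambip_comm, hun, one_apply_eq, mul_one]
    · intro j _ hj
      rw [ambip_comm, hun, one_apply_ne hj.symm, mul_zero]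
    · simp
  refine ⟨(-r⁻¹) • u, ?_, fun j hj => ?_, ?_⟩
  · rw [mem_space, ambip_smul_left, ambip_smul_right, huu]
    have : (faceGram O m)⁻¹ i i = σ.sgn * (r * r) := by
      rw [hr]; linear_combination (-(faceGram O m)⁻¹ i i) * hs
    rw [this]
    field_simp
  · rw [ambip_smul_left, hun, one_apply_ne hj.symm, mul_zero]
  · rw [ambip_smul_left, hun, one_apply_eq]
    simpa using hr0

theorem exists_dual (hσ : σ.sgn * (faceGram O m).det < 0) :
    ∃ (N V : Fin 4 → Fin 4 → ℝ) (E : Fin 3 → tangent σ (V 3)), IsVertexDual σ N V ∧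
      IsFrame σ (V 3) E ∧ (∀ i j, ambip σ (N i) (N j) = faceGram O m i j) ∧
      ∀ i, i ≠ 3 → N i = frameVec E (m i) := by
  obtain ⟨p, E, hp, hE⟩ := exists_frame σ
  obtain ⟨N, hNE, hN3, hN⟩ := exists_normals hχ hσ hp hE
  have hv : ∀ i, ∃ v ∈ space σ, (∀ j, j ≠ i → ambip σ v (N j) = 0) ∧ ambip σ v (N i) < 0 ∧
      (i = 3 → v = p) := by
    intro i
    by_cases hi : i = 3
    -- The last vertex must be the given base point, where the frame lives.
    · subst hi
      refine ⟨p, hp, fun j hj => ?_, hN3, fun _ => rfl⟩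
      rw [hNE j hj, ambip_comm, frameVec_mem]
    · obtain ⟨v, hv1, hv2, hv3⟩ := exists_vertex h hχ hσ hN i
      exact ⟨v, hv1, hv2, hv3, fun h => absurd h hi⟩
  choose V hV1 hV2 hV3 hV4 using hv
  have hVp := hV4 3 rfl
  subst hVp
  exact ⟨N, V, E, ⟨hV1, hV2, hV3⟩, hE, hN, hNE⟩

/-- No edge of the reconstructed tetrahedron joins two points with `σ⟨p,q⟩ = -1`. -/
theorem edge_ne {N V : Fin 4 → Fin 4 → ℝ} (hD : IsVertexDual σ N V)
    (hN : ∀ i j, ambip σ (N i) (N j) = faceGram O m i j) {i j : Fin 4} (hij : i ≠ j) :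
    1 + σ.sgn * ambip σ (V i) (V j) ≠ 0 := by
  intro h0
  have hs := σ.sgn_mul_self
  have hVV : ambip σ (V i) (V j) = -σ.sgn := by
    linear_combination σ.sgn * h0 - ambip σ (V i) (V j) * hs
  have hVV' : ambip σ (V j) (V i) = -σ.sgn := by rw [ambip_comm, hVV]
  obtain ⟨a, ha, -⟩ := hD.exists_eq_sum i
  obtain ⟨b, hb, -⟩ := hD.exists_eq_sum j
  -- If the edge were exceptional, `V i + V j` would be orthogonal to `V i` and `V j`, so its
  -- coefficients at `N i` and `N j` would vanish. Its products with the normals are zero at the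
  -- other two indices and negative at `i` and `j`, which `not_neg_of_faceGram` forbids.
  have hν : V i + V j = ∑ k, (a + b) k • N k := by
    conv_lhs => rw [ha, hb]
    simp only [Pi.add_apply, add_smul, Finset.sum_add_distrib]
  have hrow : ∀ k, ∑ l, (a + b) l * faceGram O m l k = ambip σ (V i) (N k) + ambip σ (V j) (N k) := by
    intro k
    rw [← ambip_add_left, hν, ambip_sum_left]
    simp only [hN]
  have hcoef : ∀ k, ambip σ (V k) (V i + V j) = 0 → (a + b) k = 0 := by
    intro k hk
    rw [hν, hD.ambip_sum] at hk
    exact (mul_eq_zero.1 hk).resolve_right (hD.neg k).ne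
  refine h.not_neg_of_faceGram hχ hij (a + b) (hcoef i ?_) (hcoef j ?_) (fun k hki hkj => ?_)
    ⟨?_, ?_⟩
  · rw [ambip_add_right, hVV, mem_space.1 (hD.mem i), add_neg_cancel]
  · rw [ambip_add_right, hVV', mem_space.1 (hD.mem j), neg_add_cancel]
  · rw [hrow, hD.orthogonal i k hki, hD.orthogonal j k hkj, add_zero]
  · rw [hrow, hD.orthogonal j i hij, add_zero]
    exact hD.neg i
  · rw [hrow, hD.orthogonal i j hij.symm, zero_add]
    exact hD.neg j

/-- The tetrahedron with prescribed based face holonomies and transported normals. -/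
theorem exists_tetrahedron (hσ : σ.sgn * (faceGram O m).det < 0) :
    ∃ (N V : Fin 4 → Fin 4 → ℝ) (E : Fin 3 → tangent σ (V 3))
      (o : ∀ a b : Fin 4, tangent σ (V b) →ₗ[ℝ] tangent σ (V a)), IsVertexDual σ N V ∧
      (∀ i j, ambip σ (N i) (N j) = faceGram O m i j) ∧ IsFrame σ (V 3) E ∧
      IsTransportSystem σ V o ∧ TransportedNormalsAre N o E m ∧ HolonomiesAre o E O := by
  obtain ⟨N, V, E, hD, hE, hN, hNE⟩ := exists_dual h hχ hσ
  have ho : ∀ a b : Fin 4, ∃ L : tangent σ (V b) →ₗ[ℝ] tangent σ (V a),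
      a ≠ b → IsEdgeTransport σ (V b) (V a) L := by
    intro a b
    by_cases hab : a = b
    · exact ⟨0, fun h => absurd hab h⟩
    · obtain ⟨L, hL⟩ := exists_isEdgeTransport (hD.mem b) (hD.mem a)
        (edge_ne h hχ hD hN (Ne.symm hab))
      exact ⟨L, fun _ => hL⟩
  choose o ho using ho
  have ho : IsTransportSystem σ V o := ho
  obtain ⟨m', hT⟩ := exists_transportedNormals hD ho hE
  have hm' : ∀ i, i ≠ 3 → m' i = m i := fun i hi =>
    frameVec_injective hE ((hT.1 i hi).symm.trans (hNE i hi))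
  have hcoord : ∀ i b, ∃ x, (faceHolonomy o i (E b) : Fin 4 → ℝ) = frameVec E x :=
    fun i b => exists_frameVec hE (faceHolonomy o i (E b)).2
  choose x hx using hcoord
  obtain ⟨O', hO'⟩ : ∃ O' : Fin 4 → Matrix (Fin 3) (Fin 3) ℝ, ∀ i a b, O' i a b = x i b a :=
    ⟨fun i => Matrix.of fun a b => x i b a, fun _ _ _ => rfl⟩
  have hhol : HolonomiesAre o E O' := by
    intro i b
    apply Subtype.ext
    rw [coe_sum_smul E (fun a => O' i a b), hx]
    congr 1
    funext a
    rw [hO']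
  have h' := isHolonomyData hD ho hE hhol hT
  have hG : faceGram O m = faceGram O' m' := by
    ext i j
    rw [faceGram_eq_ambip hD ho hE hhol hT, hN]
  obtain ⟨κ, hκ⟩ := exists_chi_pos hD ho hE hhol hT
  -- This triple product involves only the normals tangent at the base, which are already the
  -- prescribed ones; it fixes the common sign as positive.
  have hχ3 : chi O' m' 3 = chi O m 3 := by
    rw [chi_three, chi_three, hm' 0 (by decide), hm' 1 (by decide), hm' 2 (by decide)]
  have hκ0 : 0 < κ := by
    have := hκ 3
    rw [hχ3] at this
    exact (mul_pos_iff_of_pos_right (hχ 3)).1 this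
  have hχ' : ∀ i, 0 < chi O' m' i := fun i => (mul_pos_iff_of_pos_left hκ0).1 (hκ i)
  obtain ⟨hmm, hOO⟩ := h.eq_of_faceGram_eq h' hG hχ hχ' fun i hi => (hm' i hi).symm
  rw [← hmm] at hT
  rw [← hOO] at hhol
  exact ⟨N, V, E, o, hD, hN, hE, ho, hT, hhol⟩

end

/-! ### Rescaling the normals -/

section
variable (O : Fin 4 → Matrix (Fin 3) (Fin 3) ℝ) (n : Fin 4 → Fin 3 → ℝ) (s : Fin 4 → ℝ)

theorem tanip_lcross_smul (a b c : ℝ) (u v w : Fin 3 → ℝ) :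
    tanip (lcross (a • u) (b • v)) (c • w) = a * b * c * tanip (lcross u v) w := by
  simp only [tanip_eq, lcross_apply_zero, lcross_apply_one, lcross_apply_two, Pi.smul_apply,
    smul_eq_mul]
  ring

theorem chi_smul_zero : chi O (fun i => s i • n i) 0 = s 1 * s 2 * s 3 * chi O n 0 := by
  rw [chi_zero, chi_zero, mulVec_smul, tanip_lcross_smul]; ring

theorem chi_smul_one : chi O (fun i => s i • n i) 1 = s 0 * s 2 * s 3 * chi O n 1 := by
  rw [chi_one, chi_one, tanip_lcross_smul]

theorem chi_smul_two : chi O (fun i => s i • n i) 2 = s 0 * s 1 * s 3 * chi O n 2 := by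
  rw [chi_two, chi_two, mulVec_smul, tanip_lcross_smul]; ring

theorem chi_smul_three : chi O (fun i => s i • n i) 3 = s 0 * s 1 * s 2 * chi O n 3 := by
  rw [chi_three, chi_three, tanip_lcross_smul]

theorem faceGram_smul (i j : Fin 4) :
    faceGram O (fun i => s i • n i) i j = s i * s j * faceGram O n i j := by
  by_cases h : (i = 1 ∧ j = 3) ∨ (i = 3 ∧ j = 1)
  · rcases h with ⟨rfl, rfl⟩ | ⟨rfl, rfl⟩
    · simp only [faceGram_one_three, mulVec_smul, tanip_smul_left, tanip_smul_right]; ring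
    · simp only [faceGram_three_one, mulVec_smul, tanip_smul_left, tanip_smul_right]; ring
  · rw [faceGram_apply O _ h, faceGram_apply O n h, tanip_smul_left, tanip_smul_right]; ring

theorem det_faceGram_smul :
    (faceGram O fun i => s i • n i).det = (∏ i, s i) ^ 2 * (faceGram O n).det := by
  have h : faceGram O (fun i => s i • n i) =
      Matrix.diagonal s * faceGram O n * Matrix.diagonal s := by
    ext i j
    rw [faceGram_smul, Matrix.mul_diagonal, Matrix.diagonal_mul]; ring
  rw [h, det_mul, det_mul, det_diagonal]; ring

end

/-! ### The outward branch -/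

section
variable {O : Fin 4 → Matrix (Fin 3) (Fin 3) ℝ} {n m m' : Fin 4 → Fin 3 → ℝ}

theorem SignChange.exists_signs (h : SignChange n m) :
    ∃ s : Fin 4 → ℝ, (∀ i, s i = 1 ∨ s i = -1) ∧ m = fun i => s i • n i := by
  have : ∀ i, ∃ t : ℝ, (t = 1 ∨ t = -1) ∧ m i = t • n i := fun i => by
    rcases h i with h | h
    · exact ⟨1, Or.inl rfl, by rw [h, one_smul]⟩
    · exact ⟨-1, Or.inr rfl, by rw [h, neg_one_smul]⟩
  choose s hs hm using this
  exact ⟨s, hs, funext hm⟩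

theorem signChange_smul {s : Fin 4 → ℝ} (hs : ∀ i, s i = 1 ∨ s i = -1) :
    SignChange n fun i => s i • n i := fun i => by
  rcases hs i with h | h <;> simp [h]

theorem SignChange.neg (h : SignChange n m) : SignChange n (-m) := fun i => by
  rcases h i with h | h <;> simp [h]

theorem SignChange.trans_symm (h : SignChange n m) (h' : SignChange n m') : SignChange m m' :=
  fun i => by rcases h i with h | h <;> rcases h' i with h' | h' <;> simp [h, h']

theorem neg_eq_smul (m : Fin 4 → Fin 3 → ℝ) : -m = fun i => (-1 : ℝ) • m i := by
  funext i; simp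

theorem chi_neg (O : Fin 4 → Matrix (Fin 3) (Fin 3) ℝ) (m : Fin 4 → Fin 3 → ℝ) (i : Fin 4) :
    chi O (-m) i = -chi O m i := by
  rw [neg_eq_smul]
  fin_cases i
  · exact (chi_smul_zero O m fun _ => -1).trans (by norm_num)
  · exact (chi_smul_one O m fun _ => -1).trans (by norm_num)
  · exact (chi_smul_two O m fun _ => -1).trans (by norm_num; rfl)
  · exact (chi_smul_three O m fun _ => -1).trans (by norm_num; rfl)

/-- With `e i` the sign of `χ_i` and `P` the product of all four, the signs `P * e i` work: the
product of three of them is `P³ * (P * e i) = e i`, where `i` is the omitted index. -/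
theorem exists_outwardBranch (h : ∀ i, chi O n i ≠ 0) : ∃ m, IsOutwardBranch O n m := by
  have he : ∀ i, ∃ e : ℝ, (e = 1 ∨ e = -1) ∧ 0 < e * chi O n i := fun i => by
    rcases lt_or_gt_of_ne (h i) with h | h
    · exact ⟨-1, Or.inr rfl, by linarith⟩
    · exact ⟨1, Or.inl rfl, by linarith⟩
  choose e he hpos using he
  have hsq : ∀ i, e i * e i = 1 := fun i => by rcases he i with h | h <;> rw [h] <;> norm_num
  obtain ⟨P, hP⟩ : ∃ P, P = e 0 * e 1 * e 2 * e 3 := ⟨_, rfl⟩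
  have hPP : P = 1 ∨ P = -1 := by
    rw [hP]
    rcases he 0 with h0 | h0 <;> rcases he 1 with h1 | h1 <;> rcases he 2 with h2 | h2 <;>
      rcases he 3 with h3 | h3 <;> simp [h0, h1, h2, h3]
  have hP2 : P * P = 1 := by rcases hPP with h | h <;> rw [h] <;> norm_num
  refine ⟨fun i => (P * e i) • n i, signChange_smul fun i => ?_, fun i => ?_⟩
  · rcases hPP with h | h <;> rcases he i with h' | h' <;> simp [h, h']
  · have h0 := hsq 0
    have h1 := hsq 1
    have h2 := hsq 2
    have h3 := hsq 3
    fin_cases i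
    · refine lt_of_lt_of_eq (hpos 0) (Eq.trans ?_ (chi_smul_zero O n _).symm)
      congr 1
      have hx : P * (e 1 * e 2 * e 3) = e 0 := by
        rw [hP]
        linear_combination e 0 * e 2 ^ 2 * e 3 ^ 2 * h1 + e 0 * e 3 ^ 2 * h2 + e 0 * h3
      linear_combination (-1) * hx - P * (e 1 * e 2 * e 3) * hP2
    · refine lt_of_lt_of_eq (hpos 1) (Eq.trans ?_ (chi_smul_one O n _).symm)
      congr 1
      have hx : P * (e 0 * e 2 * e 3) = e 1 := by
        rw [hP]
        linear_combination e 1 * e 2 ^ 2 * e 3 ^ 2 * h0 + e 1 * e 3 ^ 2 * h2 + e 1 * h3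
      linear_combination (-1) * hx - P * (e 0 * e 2 * e 3) * hP2
    · refine lt_of_lt_of_eq (hpos 2) (Eq.trans ?_ (chi_smul_two O n _).symm)
      congr 1
      have hx : P * (e 0 * e 1 * e 3) = e 2 := by
        rw [hP]
        linear_combination e 2 * e 1 ^ 2 * e 3 ^ 2 * h0 + e 2 * e 3 ^ 2 * h1 + e 2 * h3
      linear_combination (-1) * hx - P * (e 0 * e 1 * e 3) * hP2
    · refine lt_of_lt_of_eq (hpos 3) (Eq.trans ?_ (chi_smul_three O n _).symm)
      congr 1
      have hx : P * (e 0 * e 1 * e 2) = e 3 := by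
        rw [hP]
        linear_combination e 3 * e 1 ^ 2 * e 2 ^ 2 * h0 + e 3 * e 2 ^ 2 * h1 + e 3 * h2
      linear_combination (-1) * hx - P * (e 0 * e 1 * e 2) * hP2

/-- The four triple products multiply to the cube of the full product, which is thus `1`; each sign
is the full product divided by a triple product. -/
theorem eq_one_of_triple_products_pos {t : Fin 4 → ℝ} (ht : ∀ i, t i = 1 ∨ t i = -1)
    (h0 : 0 < t 1 * t 2 * t 3) (h1 : 0 < t 0 * t 2 * t 3) (h2 : 0 < t 0 * t 1 * t 3)
    (h3 : 0 < t 0 * t 1 * t 2) (i : Fin 4) : t i = 1 := by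
  have : t 0 = 1 ∧ t 1 = 1 ∧ t 2 = 1 ∧ t 3 = 1 := by
    rcases ht 0 with e0 | e0 <;> rcases ht 1 with e1 | e1 <;> rcases ht 2 with e2 | e2 <;>
      rcases ht 3 with e3 | e3 <;> first
        | exact ⟨e0, e1, e2, e3⟩
        | exfalso; rw [e1, e2, e3] at h0; rw [e0, e2, e3] at h1; rw [e0, e1, e3] at h2
          rw [e0, e1, e2] at h3; linarith
  fin_cases i
  exacts [this.1, this.2.1, this.2.2.1, this.2.2.2]

theorem IsOutwardBranch.unique (h : IsOutwardBranch O n m) (h' : IsOutwardBranch O n m') :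
    m' = m := by
  obtain ⟨t, ht, rfl⟩ := (h.1.trans_symm h'.1).exists_signs
  have h0 := h'.2 0
  have h1 := h'.2 1
  have h2 := h'.2 2
  have h3 := h'.2 3
  rw [chi_smul_zero, mul_pos_iff_of_pos_right (h.2 0)] at h0
  rw [chi_smul_one, mul_pos_iff_of_pos_right (h.2 1)] at h1
  rw [chi_smul_two, mul_pos_iff_of_pos_right (h.2 2)] at h2
  rw [chi_smul_three, mul_pos_iff_of_pos_right (h.2 3)] at h3
  funext i
  rw [eq_one_of_triple_products_pos ht h0 h1 h2 h3 i, one_smul]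

/-- A sign change whose triple products have a common sign is, up to a common sign, the outward
branch. -/
theorem IsOutwardBranch.eq_or_eq_neg (h : IsOutwardBranch O n m) (h' : SignChange n m') {κ : ℝ}
    (hκ : ∀ i, 0 < κ * chi O m' i) : m' = m ∨ m' = -m := by
  rcases lt_or_gt_of_ne (left_ne_zero_of_mul (hκ 0).ne').symm with hk | hk
  · exact Or.inl (h.unique ⟨h', fun i => (mul_pos_iff_of_pos_left hk).1 (hκ i)⟩)
  · right
    rw [← h.unique ⟨h'.neg, fun i => ?_⟩, neg_neg]
    rw [chi_neg]
    have := hκ i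
    nlinarith

theorem IsHolonomyData.smul (h : IsHolonomyData O n) (s : Fin 4 → ℝ) :
    IsHolonomyData O fun i => s i • n i where
  isSO := h.isSO
  fixes i := by rw [mulVec_smul, h.fixes i]
  closure := h.closure

theorem selectedModel_sgn {G : Matrix (Fin 4) (Fin 4) ℝ} (hG : G.det ≠ 0) :
    (selectedModel G).sgn * G.det < 0 := by
  unfold selectedModel
  split_ifs with h
  · simpa [Model.sgn] using h
  · simpa [Model.sgn] using lt_of_le_of_ne (not_lt.1 h) hG.symm

end

/-! ### Uniqueness of the tetrahedron -/

theorem eq_model_and_congruent {σ σ' : Model} {N V N' V' : Fin 4 → Fin 4 → ℝ}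
    (hD : IsVertexDual σ N V) (hD' : IsVertexDual σ' N' V') {c : Fin 4 → ℝ} (hc : ∀ i, 0 < c i)
    (hG : ∀ i j, ambip σ' (c i • N' i) (c j • N' j) = ambip σ (N i) (N j)) :
    σ' = σ ∧ CongruentTetrahedra σ N V N' V' := by
  obtain rfl := model_eq_of_gram_eq hD.det_ne_zero hG
  exact ⟨rfl, congruentTetrahedra_of_gram_eq hD hD' hc hG⟩

/-- The based face holonomies determine the Gram matrix of suitably scaled normals. -/
theorem exists_scale_gram_eq {O : Fin 4 → Matrix (Fin 3) (Fin 3) ℝ} (hne : ∀ i, O i ≠ 1)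
    {n m : Fin 4 → Fin 3 → ℝ} (hn : IsHolonomyData O n) (hn0 : ∀ i, n i ≠ 0)
    (hm : IsOutwardBranch O n m) {σ : Model} {N V : Fin 4 → Fin 4 → ℝ} (hD : IsVertexDual σ N V)
    (hO : HasBasedHolonomies σ V O) :
    ∃ c : Fin 4 → ℝ, (∀ i, 0 < c i) ∧
      ∀ i j, ambip σ (c i • N i) (c j • N j) = faceGram O m i j := by
  obtain ⟨E, o, hE, ho, hhol⟩ := hO
  obtain ⟨m', hT⟩ := exists_transportedNormals hD ho hE
  have h' := isHolonomyData hD ho hE hhol hT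
  have hG := faceGram_eq_ambip hD ho hE hhol hT
  obtain ⟨κ, hκ⟩ := exists_chi_pos hD ho hE hhol hT
  have hl : ∀ i, ∃ t : ℝ, m' i = t • n i := fun i =>
    (hn.isSO i).exists_eq_smul (hne i) (h'.fixes i) (hn.fixes i) (hn0 i)
  choose l hl using hl
  obtain rfl : m' = fun i => l i • n i := funext hl
  have hχ : ∀ i, chi O (fun i => l i • n i) i ≠ 0 := fun i => right_ne_zero_of_mul (hκ i).ne'
  have hl0 : ∀ i, l i ≠ 0 := by
    have h0 := hχ 0
    have h3 := hχ 3
    rw [chi_smul_zero] at h0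
    rw [chi_smul_three] at h3
    intro i
    simp only [mul_ne_zero_iff] at h0 h3
    fin_cases i
    exacts [h3.1.1.1, h3.1.1.2, h3.1.2, h0.1.2]
  -- Only positive rescaling is allowed for outward normals; dividing by `|l i|` leaves `± n i`.
  have hc : ∀ i, 0 < |l i|⁻¹ := fun i => inv_pos.2 (abs_pos.2 (hl0 i))
  refine ⟨fun i => |l i|⁻¹, hc, fun i j => ?_⟩
  set m'' : Fin 4 → Fin 3 → ℝ := fun i => |l i|⁻¹ • (l i • n i) with hm''
  have hsign : SignChange n m'' := by
    have : m'' = fun i => (|l i|⁻¹ * l i) • n i := by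
      funext i; rw [hm'']; simp only [smul_smul]
    rw [this]
    refine signChange_smul fun i => ?_
    rcases abs_choice (l i) with h | h <;> rw [h]
    · left; exact inv_mul_cancel₀ (hl0 i)
    · right; rw [inv_neg, neg_mul, inv_mul_cancel₀ (hl0 i)]
  have hκ' : ∀ i, 0 < κ * chi O m'' i := by
    have e : ∀ {a b c x : ℝ}, 0 < a → 0 < b → 0 < c → 0 < κ * x → 0 < κ * (a * b * c * x) := by
      intro a b c x ha hb hc hx
      rw [show κ * (a * b * c * x) = a * b * c * (κ * x) by ring]
      positivity
    intro i
    fin_cases i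
    · exact lt_of_lt_of_eq (e (hc 1) (hc 2) (hc 3) (hκ 0))
        (congrArg (κ * ·) (chi_smul_zero O _ fun i => |l i|⁻¹).symm)
    · exact lt_of_lt_of_eq (e (hc 0) (hc 2) (hc 3) (hκ 1))
        (congrArg (κ * ·) (chi_smul_one O _ fun i => |l i|⁻¹).symm)
    · exact lt_of_lt_of_eq (e (hc 0) (hc 1) (hc 3) (hκ 2))
        (congrArg (κ * ·) (chi_smul_two O _ fun i => |l i|⁻¹).symm)
    · exact lt_of_lt_of_eq (e (hc 0) (hc 1) (hc 2) (hκ 3))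
        (congrArg (κ * ·) (chi_smul_three O _ fun i => |l i|⁻¹).symm)
  -- The holonomies leave a global sign of the normals open, and the Gram matrix is insensitive to
  -- it.
  have hgram : faceGram O m'' = faceGram O m := by
    rcases hm.eq_or_eq_neg hsign hκ' with h | h
    · rw [h]
    · rw [h, neg_eq_smul]
      ext i j
      rw [faceGram_smul]; ring
  rw [← hgram, hm'', faceGram_smul, ambip_smul_left, ambip_smul_right, hG]
  ring

end HolMink

end

/-! ### Assembly of the theorem -/

open HolMink

theorem mainTheorem1
    (O : Fin 4 → Matrix (Fin 3) (Fin 3) ℝ) (hO : ∀ i, IsSOPlus (O i)) (hne : ∀ i, O i ≠ 1)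
    (hclosure : O 3 * O 2 * O 1 * O 0 = 1)
    (n : Fin 4 → Fin 3 → ℝ) (hn : ∀ i, IsNormalRepresentative (O i) (n i))
    (hG : (faceGram O n).det ≠ 0)
    (hminor : ∀ i : Fin 4, ((faceGram O n).submatrix i.succAbove i.succAbove).det ≠ 0)
    (hadm : (∃ i, IsParabolicHolonomy (O i)) → Admissible O n) :
    ∃ m : Fin 4 → Fin 3 → ℝ,
      -- the outward branch, its uniqueness, and its compatibility with the null representatives
      IsOutwardBranch O n m ∧ (∀ m', IsOutwardBranch O n m' → m' = m) ∧
      (∃ s : ℝ, (s = 1 ∨ s = -1) ∧ ∀ i, tanip (n i) (n i) = 0 → m i = s • n i) ∧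
      -- the tetrahedron, with outward normals `N` and vertices `V`
      ∃ N V : Fin 4 → Fin 4 → ℝ,
        IsStrictlyConvexTetrahedron (selectedModel (faceGram O n)) N V ∧
        (∀ i j, ambip (selectedModel (faceGram O n)) (N i) (N j) = faceGram O m i j) ∧
        (∃ (E : Fin 3 → tangent (selectedModel (faceGram O n)) (V 3))
            (o : ∀ a b : Fin 4, tangent (selectedModel (faceGram O n)) (V b) →ₗ[ℝ]
              tangent (selectedModel (faceGram O n)) (V a)),
          IsFrame (selectedModel (faceGram O n)) (V 3) E ∧
          IsTransportSystem (selectedModel (faceGram O n)) V o ∧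
          TransportedNormalsAre N o E m ∧ HolonomiesAre o E O) ∧
        -- uniqueness up to the ambient isometry group
        ∀ (σ' : Model) (N' V' : Fin 4 → Fin 4 → ℝ), IsStrictlyConvexTetrahedron σ' N' V' →
          ((∀ i j, ambip σ' (N' i) (N' j) = faceGram O m i j) ∨ HasBasedHolonomies σ' V' O) →
          σ' = selectedModel (faceGram O n) ∧ CongruentTetrahedra (selectedModel (faceGram O n)) N V N' V' := by
  have hspec := fun i => (hn i).spec (hne i)
  have hdata : IsHolonomyData O n :=
    ⟨fun i => ⟨(hO i).1, (hO i).2.1⟩, fun i => (hspec i).1, hclosure⟩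
  have hχ : ∀ i, chi O n i ≠ 0 := by
    intro i h0
    apply hminor i
    rw [hdata.det_submatrix, h0]; simp
  obtain ⟨m, hm⟩ := exists_outwardBranch hχ
  refine ⟨m, hm, fun m' hm' => hm.unique hm', ?_, ?_⟩
  -- A null representative makes its holonomy parabolic, so admissibility applies. The admissible
  -- pattern, which keeps the null vectors, agrees with the outward branch up to one global sign,
  -- and that is `s`.
  · by_cases hnull : ∃ i, tanip (n i) (n i) = 0
    · obtain ⟨i, hi⟩ := hnull
      obtain ⟨m', hm', hm'n, hsign⟩ := hadm ⟨i, (hspec i).2.2 hi⟩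
      have hκ : ∃ κ : ℝ, ∀ i, 0 < κ * chi O m' i := by
        rcases hsign with h | h
        · exact ⟨1, fun i => by rw [one_mul]; exact h i⟩
        · exact ⟨-1, fun i => by linarith [h i]⟩
      obtain ⟨κ, hκ⟩ := hκ
      rcases hm.eq_or_eq_neg hm' hκ with h | h
      · exact ⟨1, Or.inl rfl, fun i hi => by rw [one_smul, ← h, hm'n i hi]⟩
      · refine ⟨-1, Or.inr rfl, fun i hi => ?_⟩
        rw [neg_one_smul, ← hm'n i hi, h, Pi.neg_apply, neg_neg]
    · exact ⟨1, Or.inl rfl, fun i hi => absurd ⟨i, hi⟩ hnull⟩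
  have hdatam : IsHolonomyData O m := by
    obtain ⟨s, -, rfl⟩ := hm.1.exists_signs
    exact hdata.smul s
  -- Sign changes multiply the determinant by a square, so the model selected by `n` is the right
  -- one for `m`.
  have hσ : (selectedModel (faceGram O n)).sgn * (faceGram O m).det < 0 := by
    obtain ⟨s, hs, hms⟩ := hm.1.exists_signs
    have hs0 : (∏ i, s i) ^ 2 = 1 := by
      rw [← Finset.prod_pow]
      exact Finset.prod_eq_one fun i _ => by rcases hs i with h | h <;> rw [h] <;> norm_num
    rw [hms, det_faceGram_smul, hs0, one_mul]
    exact selectedModel_sgn hG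
  obtain ⟨N, V, E, o, hD, hN, hE, ho, hT, hhol⟩ := exists_tetrahedron hdatam hm.2 hσ
  refine ⟨N, V, hD.isStrictlyConvexTetrahedron, hN, ⟨E, o, hE, ho, hT, hhol⟩, ?_⟩
  intro σ' N' V' hconv h
  have hD' := hconv.isVertexDual
  rcases h with h | h
  · refine eq_model_and_congruent hD hD' (c := fun _ => 1) (fun _ => one_pos) fun i j => ?_
    rw [one_smul, one_smul, h, hN]
  · obtain ⟨c, hc, hgram⟩ := exists_scale_gram_eq hne hdata (fun i => (hspec i).2.1) hm hD' h
    refine eq_model_and_congruent hD hD' hc fun i j => ?_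
    rw [hgram, hN]
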